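/- Let $d\ge 1$ and let $\Omega\subset\mathbb{R}^d$ be open, bounded and connected. Let $\mathcal{M}$ be a finite simplicial face-to-face mesh of $\Omega$: a finite set of closed nondegenerate $d$-simplices with union $\overline\Omega$, any two of which intersect in the (possibly empty) simplex spanned by their common vertices. An interelement face $F\in\mathcal{F}$ is an intersection $F=K_1\cap K_2$ of two elements that is a simplex with $d$ vertices; its patch is $\omega_F=K_1\cup K_2$. Assume that $\mathring K\subset\Omega$ for all $K\in\mathcal{M}$ and $\mathring\omega_F\subset\Omega$ for all $F\in\mathcal{F}$. Let $\phi_z$ be the continuous, piecewise affine nodal basis function of the vertex $z$ (extended by $0$ off $\overline\Omega$), let $H^{-1}(\Omega)$ be the dual space of $H^1_0(\Omega)$, and define functionals $\chi_K,\chi_F\in H^{-1}(\Omega)$ by \[ \langle\chi_K,v\rangle=\int_K v\,dx\quad(K\in\mathcal{M}),\qquad \langle\chi_F,v\rangle=\int_F v\,ds\quad(F\in\mathcal{F}), \] where $v$ on $F$ is understood in the sense of traces and $ds$ is the $(d-1)$-dimensional Hausdorff measure. Put \[ \mathbb{D}(\mathcal{M})=\Big\{\sum_{K\in\mathcal{M}}c_K\chi_K+\sum_{F\in\mathcal{F}}c_F\chi_F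 : c_K,c_F\in\mathbb{R}\Big\}\subset H^{-1}(\Omega), \] \[ \psi_K=\frac{(2d+1)!}{d!\,|K|}\prod_{z\in K\text{ vertex}}\phi_z,\qquad \psi_F=\frac{(2d-1)!}{(d-1)!\,|F|}\Big(\prod_{z\in F\text{ vertex}}\phi_z\Big)\Big(1-(2d+1)(\phi_{z_1}+\phi_{z_2})\Big), \] where $z_1,z_2$ are the vertices of $\omega_F$ opposite to $F$, and \[ P_{\mathcal{M}}\ell=\sum_{K\in\mathcal{M}}\langle\ell,\psi_K\rangle\chi_K+\sum_{F\in\mathcal{F}}\langle\ell,\psi_F\rangle\chi_F,\qquad \ell\in H^{-1}(\Omega). \] For open $\omega\subset\Omega$, say that $\ell_1=\ell_2$ on $\omega$ if $\ell_1(v)=\ell_2(v)$ for all $v\in H^1_0(\omega)$, and that $\ell\in\mathbb{D}(\mathcal{M})$ on $\omega$ if $\ell=\ell'$ on $\omega$ for some $\ell'\in\mathbb{D}(\mathcal{M})$. Then the functions $\psi_K,\psi_F$ belong to $H^1_0(\Omega)$ and each $F\in\mathcal{F}$ admits a continuous trace operator $H^1_0(\Omega)\to L^1(F)$ extending the restriction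 of test functions (so that $P_{\mathcal{M}}$ is well defined), and the following hold. Local invariance: for every $\ell\in H^{-1}(\Omega)$, $K\in\mathcal{M}$ and $F\in\mathcal{F}$, (i) if $\ell\in\mathbb{D}(\mathcal{M})$ on $\mathring K$, then $P_{\mathcal{M}}\ell=\ell$ on $\mathring K$; (ii) if $\ell\in\mathbb{D}(\mathcal{M})$ on $\mathring\omega_F$, then $P_{\mathcal{M}}\ell=\ell$ on $\mathring\omega_F$. Global invariance: $P_{\mathcal{M}}$ is a linear projection of $H^{-1}(\Omega)$ onto $\mathbb{D}(\mathcal{M})$, that is, it is linear, $P_{\mathcal{M}}P_{\mathcal{M}}=P_{\mathcal{M}}$, its range is $\mathbb{D}(\mathcal{M})$, and it is the identity on $\mathbb{D}(\mathcal{M})$. In particular $P_{\mathcal{M}}(\Delta V)=\Delta V$ for every $V\in H^1_0(\Omega)$ that is affine on each element of $\mathcal{M}$, where $\langle\Delta V,v\rangle=-\int_\Omega\nabla V\cdot\nabla v\,dx$, and $P_{\mathcal{M}}g=g$ for every function $g$ on $\Omega$ that is constant on each element of $\mathcal{M}$, where $g$ is identified with $v\mapsto\int_\Omega g\,v\,dx$.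 -/

import Mathlib

open MeasureTheory Set
open scoped RealInnerProductSpace

noncomputable section

namespace FEM

/-- The Euclidean space `ℝ^d`. -/
abbrev E (d : ℕ) : Type := EuclideanSpace ℝ (Fin d)

/-! ### Sobolev space with zero boundary values and its dual -/

/-- The ambient space of pairs (function, gradient) in `L²(ℝ^d) × L²(ℝ^d; ℝ^d)`. -/
abbrev Pairs (d : ℕ) : Type :=
  Lp ℝ 2 (volume : Measure (E d)) × Lp (E d) 2 (volume : Measure (E d))

/-- Infinitely differentiable functions with compact support in `ω`. -/
def IsTest {d : ℕ} (ω : Set (E d)) (φ : E d → ℝ) : Prop :=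
  ContDiff ℝ (⊤ : ℕ∞) φ ∧ HasCompactSupport φ ∧ tsupport φ ⊆ ω

/-- The pair `p` is `(φ, ∇φ)`. -/
def IsPairOf {d : ℕ} (p : Pairs d) (φ : E d → ℝ) : Prop :=
  (p.1 : E d → ℝ) =ᵐ[volume] φ ∧ (p.2 : E d → E d) =ᵐ[volume] gradient φ

/-- The subspace of all pairs `(φ, ∇φ)` with a test function `φ ∈ C_c^∞(ω)`. -/
def testPairs {d : ℕ} (ω : Set (E d)) : Submodule ℝ (Pairs d) where
  carrier := {p | ∃ φ, IsTest ω φ ∧ IsPairOf p φ}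
  zero_mem' := by
    refine ⟨0, ⟨contDiff_const, HasCompactSupport.zero, by simp⟩, Lp.coeFn_zero _ _ _, ?_⟩
    refine (Lp.coeFn_zero _ _ _).trans (Filter.Eventually.of_forall fun x => ?_)
    simp [gradient]
  add_mem' := by
    rintro p q ⟨φ, ⟨h1, h2, h3⟩, h4, h5⟩ ⟨χ, ⟨k1, k2, k3⟩, k4, k5⟩
    refine ⟨φ + χ, ⟨h1.add k1, h2.add k2, ?_⟩, ?_, ?_⟩
    · exact (tsupport_add φ χ).trans (union_subset h3 k3)
    · exact (Lp.coeFn_add _ _).trans (h4.add k4)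
    · refine (Lp.coeFn_add _ _).trans ((h5.add k5).trans (Filter.Eventually.of_forall fun x => ?_))
      have e := fderiv_add (h1.differentiable (by simp) x) (k1.differentiable (by simp) x)
      simp [gradient, e]
  smul_mem' := by
    rintro c p ⟨φ, ⟨h1, h2, h3⟩, h4, h5⟩
    refine ⟨c • φ, ⟨h1.const_smul c, h2.smul_left, ?_⟩, ?_, ?_⟩
    · exact (tsupport_smul_subset_right (fun _ => c) φ).trans h3
    · exact (Lp.coeFn_smul c p.1).trans (h4.const_smul c)
    · refine (Lp.coeFn_smul c p.2).trans
        ((h5.const_smul c).trans (Filter.Eventually.of_forall fun x => ?_))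
      have e := fderiv_const_smul (h1.differentiable (by simp) x) c
      simp [gradient, e]

/-- `H¹₀(ω)`: the closure of `C_c^∞(ω)` in the `H¹`-norm. An element is the pair `(v, ∇v)` of the
function and its weak gradient, both extended by zero to `ℝ^d` (they vanish a.e. off `ω`), so that
`H¹₀(ω) ⊆ H¹₀(Ω)` for `ω ⊆ Ω` is a literal inclusion. -/
def H10 {d : ℕ} (ω : Set (E d)) : Submodule ℝ (Pairs d) :=
  (testPairs ω).topologicalClosure

/-- The function underlying an element of `H¹₀(Ω)`. -/
def fn {d : ℕ} {Ω : Set (E d)} (v : H10 Ω) : Lp ℝ 2 (volume : Measure (E d)) := v.1.1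

/-- The weak gradient of an element of `H¹₀(Ω)`. -/
def grad {d : ℕ} {Ω : Set (E d)} (v : H10 Ω) : Lp (E d) 2 (volume : Measure (E d)) := v.1.2

/-- `v ↦ v` as a continuous linear map `H¹₀(Ω) → L²`. -/
def fnL {d : ℕ} (Ω : Set (E d)) : H10 Ω →L[ℝ] Lp ℝ 2 (volume : Measure (E d)) :=
  (ContinuousLinearMap.fst ℝ _ _).comp (H10 Ω).subtypeL

/-- `v ↦ ∇v` as a continuous linear map `H¹₀(Ω) → L²`. -/
def gradL {d : ℕ} (Ω : Set (E d)) : H10 Ω →L[ℝ] Lp (E d) 2 (volume : Measure (E d)) :=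
  (ContinuousLinearMap.snd ℝ _ _).comp (H10 Ω).subtypeL

/-- `H⁻¹(Ω)`, the space of continuous linear functionals on `H¹₀(Ω)`. -/
abbrev Hm1 {d : ℕ} (Ω : Set (E d)) : Type := H10 Ω →L[ℝ] ℝ

/-- `ℓ₁ = ℓ₂` on the open subset `ω ⊆ Ω`: they agree on `H¹₀(ω)`. -/
def EqOnOpen {d : ℕ} {Ω : Set (E d)} (ω : Set (E d)) (ℓ₁ ℓ₂ : Hm1 Ω) : Prop :=
  ∀ v : H10 Ω, (v : Pairs d) ∈ H10 ω → ℓ₁ v = ℓ₂ v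

open Classical in
/-- The element of `H¹₀(Ω)` given by the function `f : ℝ^d → ℝ`
(with the dummy value `0` if `f` does not belong to `H¹₀(Ω)`). -/
def toH10 {d : ℕ} (Ω : Set (E d)) (f : E d → ℝ) : H10 Ω :=
  if h : ∃ v : H10 Ω, (fn v : E d → ℝ) =ᵐ[volume] f then h.choose else 0

/-- The distributional Laplacian `⟨ΔV, v⟩ = -∫ ∇V ⬝ ∇v`. -/
def laplacian {d : ℕ} {Ω : Set (E d)} (V : H10 Ω) : Hm1 Ω :=
  -((innerSL ℝ (grad V)).comp (gradL Ω))

lemma laplacian_apply {d : ℕ} {Ω : Set (E d)} (V v : H10 Ω) :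
    laplacian V v = -∫ x, ⟪grad V x, grad v x⟫ := rfl

/-- The embedding `L²(Ω) ⊆ H⁻¹(Ω)`, `⟨g, v⟩ = ∫_Ω g v`. -/
def ofL2 {d : ℕ} {Ω : Set (E d)} (g : Lp ℝ 2 (volume.restrict Ω)) : Hm1 Ω :=
  (innerSL ℝ g).comp ((LpToLpRestrictCLM (E d) ℝ ℝ volume 2 Ω).comp (fnL Ω))

lemma ofL2_apply {d : ℕ} {Ω : Set (E d)} (g : Lp ℝ 2 (volume.restrict Ω)) (v : H10 Ω) :
    ofL2 g v = ∫ x in Ω, g x * fn v x := by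
  change ∫ x in Ω, ⟪g x, (LpToLpRestrictCLM (E d) ℝ ℝ volume 2 Ω (fn v)) x⟫ = _
  refine integral_congr_ae ?_
  filter_upwards [LpToLpRestrictCLM_coeFn (p := 2) ℝ Ω (fn v)] with x hx
  rw [hx]
  simp [mul_comm]

/-! ### Meshes -/

/-- The closed simplex spanned by a finite set of vertices. -/
abbrev hull {d : ℕ} (s : Finset (E d)) : Set (E d) := convexHull ℝ (s : Set (E d))

/-- A simplicial face-to-face mesh of `Ω ⊆ ℝ^d`. An element is given by its set of vertices. -/
structure Mesh {d : ℕ} (Ω : Set (E d)) where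
  /-- the elements -/
  elems : Finset (Finset (E d))
  /-- an element has `d + 1` vertices -/
  card_eq : ∀ K ∈ elems, K.card = d + 1
  /-- the vertices of an element are affinely independent -/
  indep : ∀ K ∈ elems, AffineIndependent ℝ ((↑) : K → E d)
  /-- two elements meet in the simplex spanned by their common vertices -/
  face_to_face : ∀ K ∈ elems, ∀ L ∈ elems,
    hull K ∩ hull L ⊆ convexHull ℝ ((K : Set (E d)) ∩ (L : Set (E d)))
  /-- the elements cover the closure of the domain -/
  cover : ⋃ K ∈ elems, hull K = closure Ω

namespace Mesh

variable {d : ℕ} {Ω : Set (E d)} (M : Mesh Ω)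

/-- The vertices of the mesh. -/
def vertices : Set (E d) := {z | ∃ K ∈ M.elems, z ∈ K}

open Classical in
/-- The interelement faces: common simplices of two elements with `d` vertices. (Two elements with
exactly `d` common vertices are automatically distinct.) -/
def faces : Finset (Finset (E d)) :=
  ((M.elems ×ˢ M.elems).image fun p => p.1 ∩ p.2).filter fun F => F.card = d

open Classical in
/-- The elements that contain the face `F`. -/
def adj (F : Finset (E d)) : Finset (Finset (E d)) := M.elems.filter fun K => F ⊆ K

/-- The patch `ω_F`: union of the elements containing the face `F`. -/
def patch (F : Finset (E d)) : Set (E d) := ⋃ K ∈ M.adj F, hull K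

open Classical in
/-- The vertices of the patch `ω_F` that are opposite to `F`. -/
def opposite (F : Finset (E d)) : Finset (E d) := (M.adj F).biUnion fun K => K \ F

/-- Continuous functions on the closure of `Ω` that are affine on each element. -/
def IsFE (V : E d → ℝ) : Prop :=
  ContinuousOn V (closure Ω) ∧ ∀ K ∈ M.elems, ∃ a : E d →ᵃ[ℝ] ℝ, EqOn V a (hull K)

/-- The nodal basis function of the vertex `z`, extended by `0` off the closure of `Ω`. -/
def IsNodal (z : E d) (φ : E d → ℝ) : Prop :=
  M.IsFE φ ∧ (∀ y ∈ M.vertices, (y = z → φ y = 1) ∧ (y ≠ z → φ y = 0)) ∧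
    ∀ x, x ∉ closure Ω → φ x = 0

variable {M} in
/-- Barycentric coordinates, as affine functions on the whole space. -/
lemma exists_affine {K : Finset (E d)} (hK : K ∈ M.elems) (z : E d) :
    ∃ a : E d →ᵃ[ℝ] ℝ, ∀ y ∈ K, (y = z → a y = 1) ∧ (y ≠ z → a y = 0) := by
  have hspan : affineSpan ℝ (range ((↑) : K → E d)) = ⊤ := by
    rw [(M.indep K hK).affineSpan_eq_top_iff_card_eq_finrank_add_one]
    simp [M.card_eq K hK]
  let b : AffineBasis K ℝ (E d) := ⟨(↑), M.indep K hK, hspan⟩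
  by_cases hz : z ∈ K
  · refine ⟨b.coord ⟨z, hz⟩, fun y hy => ⟨?_, fun h => ?_⟩⟩
    · rintro rfl
      exact b.coord_apply_eq ⟨y, hz⟩
    · refine b.coord_apply_ne (i := ⟨z, hz⟩) (j := ⟨y, hy⟩) ?_
      intro e
      exact h (congrArg Subtype.val e).symm
  · exact ⟨AffineMap.const ℝ _ 0, fun y hy => ⟨fun h => absurd (h ▸ hy) hz, fun _ => rfl⟩⟩

/-- Each vertex has a nodal basis function. -/
lemma exists_isNodal (z : E d) : ∃ φ, M.IsNodal z φ := by
  classical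
  choose! a ha using fun (K : Finset (E d)) (hK : K ∈ M.elems) => exists_affine hK z
  have agree : ∀ K ∈ M.elems, ∀ L ∈ M.elems, ∀ x ∈ hull K, x ∈ hull L → a K x = a L x := by
    intro K hK L hL x hxK hxL
    have h := M.face_to_face K hK L hL ⟨hxK, hxL⟩
    have hc : Convex ℝ ((a K - a L : E d →ᵃ[ℝ] ℝ) ⁻¹' {0}) :=
      (convex_singleton 0).affine_preimage _
    have hs : (K : Set (E d)) ∩ (L : Set (E d)) ⊆ (a K - a L : E d →ᵃ[ℝ] ℝ) ⁻¹' {0} := by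
      rintro y ⟨hyK, hyL⟩
      have h1 := ha K hK y hyK
      have h2 := ha L hL y hyL
      by_cases e : y = z
      · simp [h1.1 e, h2.1 e]
      · simp [h1.2 e, h2.2 e]
    have := convexHull_min hs hc h
    simpa [sub_eq_zero] using this
  let φ : E d → ℝ := fun x =>
    if h : ∃ K ∈ M.elems, x ∈ hull K then a h.choose x else 0
  have hφ : ∀ K ∈ M.elems, EqOn φ (a K) (hull K) := by
    intro K hK x hx
    have h : ∃ K ∈ M.elems, x ∈ hull K := ⟨K, hK, hx⟩
    have e : φ x = a h.choose x := dif_pos h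
    rw [e]
    exact agree _ h.choose_spec.1 K hK x h.choose_spec.2 hx
  refine ⟨φ, ⟨?_, fun K hK => ⟨a K, hφ K hK⟩⟩, ?_, ?_⟩
  · have hU : closure Ω = ⋃ K : M.elems, hull (K : Finset (E d)) := by
      rw [← M.cover, iUnion_subtype]
    rw [hU]
    refine (locallyFinite_of_finite _).continuousOn_iUnion (fun K => ?_) (fun K => ?_)
    · exact ((K : Finset (E d)).finite_toSet.isCompact_convexHull ℝ).isClosed
    · exact ((a K).continuous_of_finiteDimensional.continuousOn).congr (hφ K K.2)
  · rintro y ⟨K, hK, hy⟩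
    have e : φ y = a K y := hφ K hK (subset_convexHull ℝ _ hy)
    rw [e]
    exact ha K hK y hy
  · intro x hx
    refine dif_neg ?_
    rintro ⟨K, hK, hxK⟩
    refine hx ?_
    rw [← M.cover]
    exact mem_biUnion hK hxK

/-- The nodal basis function `φ_z` of the vertex `z`. -/
def nodal (z : E d) : E d → ℝ := (M.exists_isNodal z).choose

lemma nodal_spec (z : E d) : M.IsNodal z (M.nodal z) := (M.exists_isNodal z).choose_spec

end Mesh

/-! ### Surface integrals and the discretized residuals -/

/-- The volume `|K|` of an element. -/
def vol {d : ℕ} (K : Finset (E d)) : ℝ := volume.real (hull K)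

/-- The surface measure on the face `F`: the `(d-1)`-dimensional Hausdorff measure (normalized so
that it is the Lebesgue measure on hyperplanes), restricted to `F`. -/
def surf {d : ℕ} (F : Finset (E d)) : Measure (E d) :=
  (Measure.euclideanHausdorffMeasure (d - 1)).restrict (hull F)

/-- The area `|F|` of a face. -/
def area {d : ℕ} (F : Finset (E d)) : ℝ := (surf F).real univ

/-- `T` is the trace operator `H¹₀(Ω) → L¹(F)`: it is continuous and restricts test functions
to `F`. By density of the test functions there is at most one such operator. -/
def IsTraceOp {d : ℕ} {Ω : Set (E d)} (F : Finset (E d)) (T : H10 Ω →L[ℝ] Lp ℝ 1 (surf F)) : Prop :=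
  ∀ φ, IsTest Ω φ → ∀ v : H10 Ω, IsPairOf (v : Pairs d) φ → (T v : E d → ℝ) =ᵐ[surf F] φ

open Classical in
/-- The trace operator on the face `F` (with the dummy value `0` if there is none). -/
def trace {d : ℕ} (Ω : Set (E d)) (F : Finset (E d)) : H10 Ω →L[ℝ] Lp ℝ 1 (surf F) :=
  if h : ∃ T : H10 Ω →L[ℝ] Lp ℝ 1 (surf F), IsTraceOp F T then h.choose else 0

/-- The surface Dirac distribution `χ_F`, `v ↦ ∫_F v ds`. -/
def chiFace {d : ℕ} (Ω : Set (E d)) (F : Finset (E d)) : Hm1 Ω :=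
  (L1.integralCLM (α := E d) (E := ℝ) (μ := surf F)).comp (trace Ω F)

lemma chiFace_apply {d : ℕ} {Ω : Set (E d)} (F : Finset (E d)) (v : H10 Ω) :
    chiFace Ω F v = ∫ x, trace Ω F v x ∂(surf F) := by
  rw [← L1.integral_eq_integral, L1.integral_eq]
  rfl

lemma isCompact_hull {d : ℕ} (K : Finset (E d)) : IsCompact (hull K) :=
  K.finite_toSet.isCompact_convexHull ℝ

/-- The characteristic function `χ_K` of an element, as the distribution `v ↦ ∫_K v dx`. -/
def chiElem {d : ℕ} (Ω : Set (E d)) (K : Finset (E d)) : Hm1 Ω :=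
  (innerSL ℝ (indicatorConstLp 2 (isCompact_hull K).measurableSet
    (isCompact_hull K).measure_lt_top.ne (1 : ℝ))).comp (fnL Ω)

lemma chiElem_apply {d : ℕ} {Ω : Set (E d)} (K : Finset (E d)) (v : H10 Ω) :
    chiElem Ω K v = ∫ x in hull K, fn v x :=
  L2.inner_indicatorConstLp_one (𝕜 := ℝ) (isCompact_hull K).measurableSet
    (isCompact_hull K).measure_lt_top.ne (fn v)

namespace Mesh

variable {d : ℕ} {Ω : Set (E d)} (M : Mesh Ω)

/-- The space `D(M)` of discretized residuals. -/
def discreteResiduals : Set (Hm1 Ω) :=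
  {ℓ | ∃ cK cF : Finset (E d) → ℝ, ∀ v : H10 Ω,
    ℓ v = ∑ K ∈ M.elems, (∫ x in hull K, cK K * fn v x) +
      ∑ F ∈ M.faces, ∫ x, cF F * trace Ω F v x ∂(surf F)}

/-- `ℓ ∈ D(M)` on the open subset `U` of `Ω`. -/
def InDiscreteOn (U : Set (E d)) (ℓ : Hm1 Ω) : Prop :=
  ∃ ℓ' ∈ M.discreteResiduals, EqOnOpen U ℓ ℓ'

/-- The test function `ψ_K` of the element `K`. -/
def psiElem (K : Finset (E d)) (x : E d) : ℝ :=
  ((2 * d + 1).factorial : ℝ) / (d.factorial * vol K) * ∏ z ∈ K, M.nodal z x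

/-- The test function `ψ_F` of the interelement face `F`. -/
def psiFace (F : Finset (E d)) (x : E d) : ℝ :=
  ((2 * d - 1).factorial : ℝ) / ((d - 1).factorial * area F) * (∏ z ∈ F, M.nodal z x) *
    (1 - (2 * d + 1) * ∑ z ∈ M.opposite F, M.nodal z x)

/-- The operator `P_M ℓ = ∑ᵢ ⟨ℓ, ψᵢ⟩ χᵢ`, where `i` ranges over all elements and faces. -/
def proj (ℓ : Hm1 Ω) : Hm1 Ω :=
  ∑ K ∈ M.elems, ℓ (toH10 Ω (M.psiElem K)) • chiElem Ω K +
    ∑ F ∈ M.faces, ℓ (toH10 Ω (M.psiFace F)) • chiFace Ω F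

/-- The finite element functions with zero boundary values: elements of `H¹₀(Ω)` that are affine on
each element of the mesh. -/
def feSpace : Set (H10 Ω) :=
  {V | ∀ K ∈ M.elems, ∃ a : E d →ᵃ[ℝ] ℝ, ∀ᵐ x ∂(volume.restrict (hull K)), fn V x = a x}

/-- The functions on `Ω` that are constant on each element of the mesh (these are automatically
essentially bounded). -/
def piecewiseConst : Set (Lp ℝ 2 (volume.restrict Ω)) :=
  {g | ∀ K ∈ M.elems, ∃ c : ℝ, ∀ᵐ x ∂(volume.restrict Ω), x ∈ hull K → g x = c}

end Mesh

end FEM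

end

noncomputable section

namespace FEM

/-! The operator is $P\ell=\sum_i\langle\ell,\psi_i\rangle\chi_i$, so everything rests on two facts:
the $\psi_i$ are biorthogonal to the $\chi_j$, and $\psi_i$ lives in the patch of $i$. Elements and
faces are both vertex sets, and an element is its own patch (`patch_elem`), so the two local claims
are instances of one statement about `patch S`.

Biorthogonality (`residual_psiElem`, `residual_psiFace`) is mostly a matter of supports: a mesh
simplex that meets the interior of `patch S` has all of `S` among its vertices
(`subset_of_mem_interior_patch`). The one genuine cancellation is $\langle\chi_K,\psi_F\rangle=0$
for $F\subset K$. With barycentric coordinates as variables it reads $1/(2d)!-(2d+1)/(2d+1)!=0$, by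
the Dirichlet integral `integral_corner_prod_mul_pow`, which also yields the normalizing factors.
Hence $P$ reproduces every discretized residual (`proj_residual`). Locally, the $\chi_j$ with
$S\not\subseteq j$ vanish on the interior of `patch S`, and for the other $j$ the function $\psi_j$
is an admissible test function there, so only the values of $\ell$ on that patch matter
(`proj_eqOnOpen_patch`).

Three analytic ingredients are needed. A Lipschitz function vanishing off a bounded open set belongs
to $H^1_0$ of that set, and its trace is its restriction (`exists_H10_of_lipschitz`,
`exists_H10_trace_eq`). The trace operator comes from the fundamental theorem of calculus along an
edge transversal to the face (`exists_lintegral_face_le`). The same argument on an element gives the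
divergence theorem (`exists_integral_fderiv_eq`). It turns $\Delta V$ into a sum of facet integrals,
in which facets that are not interelement faces drop out because they miss $\Omega$
(`hull_erase_disjoint`). -/

/-! ### Affine parametrization of simplices -/

/-- The affine parametrization of the plane through `p` and the points `w i`. -/
def par {d m : ℕ} (p : E d) (w : Fin m → E d) (y : Fin m → ℝ) : E d :=
  p + ∑ i, y i • (w i - p)

/-- The standard simplex `{y ≥ 0, ∑ yᵢ ≤ 1}`. -/
def corner (m : ℕ) : Set (Fin m → ℝ) := {y | (∀ i, 0 ≤ y i) ∧ ∑ i, y i ≤ 1}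

lemma isClosed_corner (m : ℕ) : IsClosed (corner m) := by
  have h : corner m = (⋂ i, {y : Fin m → ℝ | 0 ≤ y i}) ∩ {y | ∑ i, y i ≤ 1} := by
    ext y; simp [corner]
  rw [h]
  refine (isClosed_iInter fun i => isClosed_le continuous_const (continuous_apply i)).inter
    (isClosed_le (by fun_prop) continuous_const)

lemma le_one_of_mem_corner {m : ℕ} {y : Fin m → ℝ} (hy : y ∈ corner m) (i : Fin m) : y i ≤ 1 :=
  (Finset.single_le_sum (fun j _ => hy.1 j) (Finset.mem_univ i)).trans hy.2

lemma isCompact_corner (m : ℕ) : IsCompact (corner m) := by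
  refine (isCompact_univ_pi (fun _ : Fin m => isCompact_Icc (a := (0 : ℝ)) (b := 1))).of_isClosed_subset
    (isClosed_corner m) fun y hy i _ => ⟨hy.1 i, le_one_of_mem_corner hy i⟩

lemma convex_corner (m : ℕ) : Convex ℝ (corner m) := by
  rintro x hx y hy a b ha hb hab
  refine ⟨fun i => ?_, ?_⟩
  · have := mul_nonneg ha (hx.1 i)
    have := mul_nonneg hb (hy.1 i)
    simp only [Pi.add_apply, Pi.smul_apply, smul_eq_mul]
    linarith
  · simp only [Pi.add_apply, Pi.smul_apply, smul_eq_mul, Finset.sum_add_distrib, ← Finset.mul_sum]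
    nlinarith [hx.2, hy.2]

section par
variable {d m : ℕ} (p : E d) (w : Fin m → E d)

lemma par_eq_linearCombination (y : Fin m → ℝ) :
    par p w y = Fintype.linearCombination ℝ (fun i => w i - p) y + p := by
  simp [par, Fintype.linearCombination_apply, add_comm]

lemma continuous_par : Continuous (par p w) := by
  unfold par
  fun_prop

/-- Applied to barycentric coordinates, this identifies the parameters `y i` and `1 - ∑ y` with the
nodal functions on the simplex. -/
lemma affine_par (a : E d →ᵃ[ℝ] ℝ) (y : Fin m → ℝ) :
    a (par p w y) = (1 - ∑ i, y i) * a p + ∑ i, y i * a (w i) := by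
  have h : par p w y = (∑ i, y i • (w i - p)) +ᵥ p := by simp [par, add_comm]
  have h2 : ∀ i, a.linear (w i - p) = a (w i) - a p := fun i => a.linearMap_vsub (w i) p
  rw [h, a.map_vadd, map_sum]
  simp only [map_smul, h2, smul_eq_mul, vadd_eq_add, mul_sub, Finset.sum_sub_distrib,
    ← Finset.sum_mul]
  ring

lemma image_par : par p w '' corner m = convexHull ℝ (insert p (range w)) := by
  apply subset_antisymm
  · rintro _ ⟨y, hy, rfl⟩
    -- The index `none` stands for the vertex `p`, which carries the remaining weight.
    have h : par p w y = ∑ o : Option (Fin m),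
        (o.elim (1 - ∑ i, y i) y) • (o.elim p w) := by
      simp only [Fintype.sum_option, Option.elim, par, smul_sub, Finset.sum_sub_distrib, sub_smul,
        one_smul, Finset.sum_smul]
      abel
    rw [h]
    refine (convex_convexHull ℝ _).sum_mem ?_ ?_ ?_
    · rintro (_ | i) -
      · simpa using hy.2
      · exact hy.1 i
    · simp [Fintype.sum_option]
    · rintro (_ | i) -
      · exact subset_convexHull ℝ _ (mem_insert _ _)
      · exact subset_convexHull ℝ _ (mem_insert_of_mem _ (mem_range_self i))
  · refine convexHull_min ?_ ?_
    · rintro _ (rfl | ⟨i, rfl⟩)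
      · exact ⟨0, ⟨fun i => le_rfl, by simp⟩, by simp [par]⟩
      · refine ⟨Pi.single i 1, ⟨fun j => ?_, by simp⟩, ?_⟩
        · by_cases h : j = i
          · subst h; simp
          · simp [h]
        · simp [par, Pi.single_apply]
    · have h : par p w '' corner m
          = (fun x => x + p) '' (Fintype.linearCombination ℝ (fun i => w i - p) '' corner m) := by
        rw [image_image]
        exact image_congr fun y _ => par_eq_linearCombination p w y
      rw [h]
      simpa only [add_comm] using ((convex_corner m).linear_image _).translate p

variable {p w}

lemma par_injective (h : LinearIndependent ℝ fun i => w i - p) :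
    Function.Injective (par p w) := by
  intro x y hxy
  simp only [par_eq_linearCombination, add_left_inj] at hxy
  exact (linearIndependent_iff_injective_fintypeLinearCombination.1 h) hxy

lemma measurableEmbedding_par (h : LinearIndependent ℝ fun i => w i - p) :
    MeasurableEmbedding (par p w) :=
  (continuous_par p w).measurableEmbedding (par_injective h)

open Measure Module in
/-- The Hausdorff measure on a plane is a multiple of the image of the Lebesgue measure. -/
lemma exists_hausdorff_eq_smul_map (h : LinearIndependent ℝ fun i => w i - p) :
    ∃ c : ENNReal, c ≠ 0 ∧ c ≠ ⊤ ∧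
      (μHE[m] : Measure (E d)).restrict (range (par p w)) = c • volume.map (par p w) := by
  let L := Fintype.linearCombination ℝ (fun i => w i - p)
  have hL : Function.Injective L := linearIndependent_iff_injective_fintypeLinearCombination.1 h
  let W := LinearMap.range L
  let e : (Fin m → ℝ) ≃ₗ[ℝ] W := LinearEquiv.ofInjective L hL
  have hW : finrank ℝ W = m := by
    rw [← e.finrank_eq]; simp
  let e' : (Fin m → ℝ) ≃L[ℝ] W := e.toContinuousLinearEquiv
  -- The direction space `W` carries two Haar measures, the transported Lebesgue measure and the
  -- Hausdorff measure. Uniqueness of Haar measure supplies the factor `c`.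
  have hH1 : ((volume : Measure (Fin m → ℝ)).map e').IsAddHaarMeasure :=
    ContinuousLinearEquiv.isAddHaarMeasure_map e' volume
  have hH2 : (μHE[m] : Measure W).IsAddHaarMeasure := by
    have := MeasureTheory.isAddHaarMeasure_euclideanHausdorffMeasure (E := W)
    rwa [hW] at this
  obtain ⟨c, hc0, hct, hc⟩ : ∃ c : ENNReal, c ≠ 0 ∧ c ≠ ⊤ ∧
      (μHE[m] : Measure W) = c • (volume : Measure (Fin m → ℝ)).map e' :=
    ⟨addHaarScalarFactor μHE[m] (volume.map e'),
      by simpa using (addHaarScalarFactor_pos_of_isAddHaarMeasure μHE[m] (volume.map e')).ne',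
      ENNReal.coe_ne_top, isAddLeftInvariant_eq_smul _ _⟩
  -- Translation by `p` is an isometric embedding of `W`, so it carries Hausdorff measure to
  -- Hausdorff measure on the plane.
  let g : W → E d := fun x => p + (x : E d)
  have hg : Isometry g := (IsometryEquiv.addLeft p).isometry.comp isometry_subtype_coe
  have hge : g ∘ e' = par p w := by
    funext y
    change p + L y = _
    rw [par_eq_linearCombination, add_comm]
  have hr : range g = range (par p w) := by
    rw [← hge, range_comp, e'.surjective.range_eq, image_univ]
  refine ⟨c, hc0, hct, ?_⟩
  rw [← hr, ← hg.map_euclideanHausdorffMeasure, hc, Measure.map_smul,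
    Measure.map_map hg.continuous.measurable e'.continuous.measurable, hge]

/-- The Jacobian `c` may stay anonymous: later integrals are only compared with the measure of the
same simplex, or with unspecified constants. -/
lemma exists_restrict_simplex_eq (h : LinearIndependent ℝ fun i => w i - p) :
    ∃ c : ENNReal, c ≠ 0 ∧ c ≠ ⊤ ∧
      (Measure.euclideanHausdorffMeasure m : Measure (E d)).restrict
        (convexHull ℝ (insert p (range w))) = c • (volume.restrict (corner m)).map (par p w) := by
  obtain ⟨c, h0, ht, hc⟩ := exists_hausdorff_eq_smul_map h
  refine ⟨c, h0, ht, ?_⟩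
  rw [← image_par]
  have hm : MeasurableSet (par p w '' corner m) :=
    (measurableEmbedding_par h).measurableSet_image.2 (isClosed_corner m).measurableSet
  have h1 : (Measure.euclideanHausdorffMeasure m : Measure (E d)).restrict (par p w '' corner m)
      = ((Measure.euclideanHausdorffMeasure m : Measure (E d)).restrict
        (range (par p w))).restrict (par p w '' corner m) := by
    rw [Measure.restrict_restrict hm, inter_eq_left.2 (image_subset_range _ _)]
  rw [h1, hc, Measure.restrict_smul, (measurableEmbedding_par h).restrict_map,
    preimage_image_eq _ (par_injective h)]

/-- Integration over a simplex in terms of its parametrization. -/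
lemma exists_integral_simplex_eq (h : LinearIndependent ℝ fun i => w i - p) :
    ∃ c : ℝ, 0 < c ∧ ∀ f : E d → ℝ,
      ∫ x in convexHull ℝ (insert p (range w)), f x ∂(Measure.euclideanHausdorffMeasure m) =
        c * ∫ y in corner m, f (par p w y) := by
  obtain ⟨c, h0, ht, hc⟩ := exists_restrict_simplex_eq h
  refine ⟨c.toReal, ENNReal.toReal_pos h0 ht, fun f => ?_⟩
  rw [hc, integral_smul_measure, (measurableEmbedding_par h).integral_map, smul_eq_mul]

end par

/-! ### Integrals over the standard simplex -/

lemma cons_mem_corner {n : ℕ} {t : ℝ} {y : Fin n → ℝ} :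
    (Fin.cons t y : Fin (n + 1) → ℝ) ∈ corner (n + 1) ↔
      y ∈ corner n ∧ t ∈ Icc 0 (1 - ∑ i, y i) := by
  simp only [corner, mem_ofPred_eq, Fin.forall_fin_succ, Fin.sum_univ_succ, Fin.cons_zero,
    Fin.cons_succ, mem_Icc]
  constructor
  · rintro ⟨⟨h1, h2⟩, h3⟩
    exact ⟨⟨h2, by linarith⟩, h1, by linarith⟩
  · rintro ⟨⟨h2, h3⟩, h1, h4⟩
    exact ⟨⟨h1, h2⟩, by linarith⟩

lemma cons_eq_piFinSuccAbove_symm (n : ℕ) :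
    (fun z : ℝ × (Fin n → ℝ) => (Fin.cons z.1 z.2 : Fin (n + 1) → ℝ)) =
      (MeasurableEquiv.piFinSuccAbove (fun _ : Fin (n + 1) => ℝ) 0).symm := by
  funext z
  rw [MeasurableEquiv.piFinSuccAbove_symm_apply, Fin.insertNthEquiv_zero]
  rfl

lemma measurePreserving_cons (n : ℕ) :
    MeasurePreserving (fun z : ℝ × (Fin n → ℝ) => (Fin.cons z.1 z.2 : Fin (n + 1) → ℝ)) := by
  have h := (volume_preserving_piFinSuccAbove (fun _ : Fin (n + 1) => ℝ) 0).symm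
  convert h using 1
  exact cons_eq_piFinSuccAbove_symm n

lemma measurableEmbedding_cons (n : ℕ) :
    MeasurableEmbedding (fun z : ℝ × (Fin n → ℝ) => (Fin.cons z.1 z.2 : Fin (n + 1) → ℝ)) := by
  have h := (MeasurableEquiv.piFinSuccAbove (fun _ : Fin (n + 1) => ℝ) 0).symm.measurableEmbedding
  convert h using 1
  exact cons_eq_piFinSuccAbove_symm n

/-- Fubini with the first coordinate innermost; by `cons_mem_corner` the slice over `y` is an
interval of length `1 - ∑ y`. -/
lemma integral_corner_succ {n : ℕ} {g : (Fin (n + 1) → ℝ) → ℝ} (hg : Continuous g) :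
    ∫ z in corner (n + 1), g z =
      ∫ y in corner n, ∫ t in (0 : ℝ)..(1 - ∑ i, y i), g (Fin.cons t y) := by
  have hm := (isClosed_corner (n + 1)).measurableSet
  have hi : IntegrableOn g (corner (n + 1)) := hg.continuousOn.integrableOn_compact (isCompact_corner _)
  rw [← integral_indicator hm, ← (measurePreserving_cons n).integral_comp
    (measurableEmbedding_cons n)]
  have hi2 := ((measurePreserving_cons n).integrable_comp_emb (measurableEmbedding_cons n)).2
    ((integrable_indicator_iff hm).2 hi)
  rw [Measure.volume_eq_prod] at hi2 ⊢
  have := integral_prod_symm _ hi2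
  simp only [Function.comp_def] at this
  rw [this, ← integral_indicator (isClosed_corner n).measurableSet]
  refine integral_congr_ae (Filter.Eventually.of_forall fun y => ?_)
  by_cases hy : y ∈ corner n
  · have hs : (0 : ℝ) ≤ 1 - ∑ i, y i := by linarith [hy.2]
    simp only [indicator_of_mem hy]
    rw [intervalIntegral.integral_of_le hs, ← integral_Icc_eq_integral_Ioc,
      ← integral_indicator measurableSet_Icc]
    refine integral_congr_ae (Filter.Eventually.of_forall fun t => ?_)
    simp only [indicator, cons_mem_corner, hy, true_and]
  · simp only [indicator_of_notMem hy]
    rw [← integral_zero ℝ ℝ]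
    refine integral_congr_ae (Filter.Eventually.of_forall fun t => ?_)
    simp only [indicator, cons_mem_corner, hy, false_and, if_false]

lemma integral_mul_sub_pow (a : ℝ) (k : ℕ) :
    ∫ t in (0 : ℝ)..a, t * (a - t) ^ k = a ^ (k + 2) / ((k + 1) * (k + 2)) := by
  have h := intervalIntegral.integral_comp_sub_left (a := 0) (b := a)
    (fun u : ℝ => (a - u) * u ^ k) a
  simp only [sub_sub_cancel, sub_self, sub_zero] at h
  rw [h]
  have h2 : ∀ u : ℝ, (a - u) * u ^ k = a * u ^ k - u ^ (k + 1) := fun u => by ring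
  simp only [h2]
  rw [intervalIntegral.integral_sub
    (Continuous.intervalIntegrable (by fun_prop) _ _)
    (Continuous.intervalIntegrable (by fun_prop) _ _), intervalIntegral.integral_const_mul,
    integral_pow, integral_pow]
  have : (k : ℝ) + 1 ≠ 0 := by positivity
  have : (k : ℝ) + 2 ≠ 0 := by positivity
  push_cast
  field_simp
  ring

lemma integral_sub_pow (a : ℝ) (k : ℕ) :
    ∫ t in (0 : ℝ)..a, (a - t) ^ k = a ^ (k + 1) / (k + 1) := by
  have h := intervalIntegral.integral_comp_sub_left (a := 0) (b := a) (fun u : ℝ => u ^ k) a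
  simp only [sub_self, sub_zero] at h
  rw [h, integral_pow]
  simp

/-- Integrating out one variable raises the exponent by one, hence the induction on `n` with `k`
free. The case `k = 0` is the volume of the standard simplex. -/
lemma integral_corner_pow (n k : ℕ) :
    ∫ y in corner n, (1 - ∑ i, y i) ^ k = (k.factorial : ℝ) / (n + k).factorial := by
  induction n generalizing k with
  | zero =>
    have : corner 0 = univ := by ext; simp [corner]
    have hk : (k.factorial : ℝ) ≠ 0 := by positivity
    simp [this, hk, Measure.volume_pi_eq_dirac 0]
  | succ n ih =>
    rw [integral_corner_succ (by fun_prop)]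
    have h : ∀ (y : Fin n → ℝ), ∫ t in (0 : ℝ)..(1 - ∑ i, y i),
        (1 - ∑ i, (Fin.cons t y : Fin (n + 1) → ℝ) i) ^ k
          = (1 - ∑ i, y i) ^ (k + 1) * (1 / (k + 1)) := by
      intro y
      have := integral_sub_pow (1 - ∑ i, y i) k
      simp only [Fin.sum_univ_succ, Fin.cons_zero, Fin.cons_succ, sub_add_eq_sub_sub_swap]
      rw [this]; ring
    simp only [h, integral_mul_const, ih]
    rw [show n + (k + 1) = n + 1 + k by ring, Nat.factorial_succ k]
    push_cast
    field_simp

/-- A Dirichlet integral: here each integration raises the exponent by two. The exponents `0` and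
`1` give the integrals of the nodal products over a facet's vertices and over all vertices. -/
lemma integral_corner_prod_mul_pow (n k : ℕ) :
    ∫ y in corner n, (∏ i, y i) * (1 - ∑ i, y i) ^ k
      = (k.factorial : ℝ) / (2 * n + k).factorial := by
  induction n generalizing k with
  | zero =>
    have : corner 0 = univ := by ext; simp [corner]
    have hk : (k.factorial : ℝ) ≠ 0 := by positivity
    simp [this, hk, Measure.volume_pi_eq_dirac 0]
  | succ n ih =>
    rw [integral_corner_succ (by fun_prop)]
    have h : ∀ (y : Fin n → ℝ), ∫ t in (0 : ℝ)..(1 - ∑ i, y i),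
        (∏ i, (Fin.cons t y : Fin (n + 1) → ℝ) i) *
          (1 - ∑ i, (Fin.cons t y : Fin (n + 1) → ℝ) i) ^ k
          = ((∏ i, y i) * (1 - ∑ i, y i) ^ (k + 2)) * (1 / ((k + 1) * (k + 2))) := by
      intro y
      have := integral_mul_sub_pow (1 - ∑ i, y i) k
      simp only [Fin.sum_univ_succ, Fin.prod_univ_succ, Fin.cons_zero, Fin.cons_succ,
        sub_add_eq_sub_sub_swap]
      have h2 : ∀ t : ℝ, t * (∏ i, y i) * (1 - ∑ i, y i - t) ^ k
          = (∏ i, y i) * (t * (1 - ∑ i, y i - t) ^ k) := fun t => by ring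
      simp only [h2, intervalIntegral.integral_const_mul]
      rw [this]; ring
    simp only [h, integral_mul_const, ih]
    rw [show 2 * n + (k + 2) = 2 * (n + 1) + k by ring, Nat.factorial_succ (k + 1),
      Nat.factorial_succ k]
    push_cast
    field_simp
    ring

/-! ### Integration along edges -/

section edges
variable {n : ℕ} {p q : E (n + 1)} {w : Fin n → E (n + 1)}

lemma par_cons (t : ℝ) (y : Fin n → ℝ) :
    par p (Fin.cons q w : Fin (n + 1) → E (n + 1)) (Fin.cons t y) = par p w y + t • (q - p) := by
  simp only [par, Fin.sum_univ_succ, Fin.cons_zero, Fin.cons_succ]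
  abel

/-- A segment in direction `q - p` that starts on the facet without `q` leaves the simplex on the
facet without `p`, at the same parameter `y`. -/
lemma par_add_smul (y : Fin n → ℝ) :
    par p w y + (1 - ∑ i, y i) • (q - p) = par q w y := by
  simp only [par, smul_sub, Finset.sum_sub_distrib, ← Finset.sum_smul, sub_smul, one_smul]
  abel

lemma linearIndependent_cons_swap
    (h : LinearIndependent ℝ fun i => (Fin.cons q w : Fin (n + 1) → E (n + 1)) i - p) :
    (LinearIndependent ℝ fun i => w i - p) ∧ LinearIndependent ℝ fun i => w i - q := by
  have h1 : LinearIndependent ℝ fun i => w i - p := by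
    simpa [Function.comp_def] using h.comp Fin.succ (Fin.succ_injective n)
  refine ⟨h1, ?_⟩
  rw [Fintype.linearIndependent_iff] at h ⊢
  intro g hg i
  -- A relation among the `w i - q` becomes one among the `w i - p` and `q - p`, where `q - p`
  -- receives the coefficient `-∑ g`.
  have := h (Fin.cons (-∑ i, g i) g) (by
    simp only [Fin.sum_univ_succ, Fin.cons_zero, Fin.cons_succ]
    rw [← hg]
    simp only [smul_sub, Finset.sum_sub_distrib, ← Finset.sum_smul, neg_smul]
    abel) i.succ
  simpa using this

/-- The divergence theorem on a simplex in the direction of an edge. -/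
lemma exists_integral_fderiv_edge_eq
    (h : LinearIndependent ℝ fun i => (Fin.cons q w : Fin (n + 1) → E (n + 1)) i - p) :
    ∃ a b : ℝ, ∀ φ : E (n + 1) → ℝ, ContDiff ℝ 1 φ →
      ∫ x in convexHull ℝ (insert p (insert q (range w))), fderiv ℝ φ x (q - p) =
        a * (∫ x in convexHull ℝ (insert q (range w)), φ x ∂(Measure.euclideanHausdorffMeasure n)) +
        b * ∫ x in convexHull ℝ (insert p (range w)), φ x ∂(Measure.euclideanHausdorffMeasure n) := by
  obtain ⟨hp, hq⟩ := linearIndependent_cons_swap h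
  obtain ⟨c, hc, hci⟩ := exists_integral_simplex_eq h
  obtain ⟨a, ha, hai⟩ := exists_integral_simplex_eq hq
  obtain ⟨b, hb, hbi⟩ := exists_integral_simplex_eq hp
  -- The Jacobian of the simplex divided by those of the two facets; the signs are those of upper
  -- and lower endpoint in the inner integral.
  refine ⟨c / a, -(c / b), fun φ hφ => ?_⟩
  rw [hai, hbi]
  rw [EuclideanSpace.euclideanHausdorffMeasure_eq_volume, Fin.range_cons] at hci
  have hcont : Continuous fun x => fderiv ℝ φ x (q - p) :=
    (hφ.continuous_fderiv one_ne_zero).clm_apply continuous_const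
  have hcp : Continuous fun y => fderiv ℝ φ
      (par p (Fin.cons q w : Fin (n + 1) → E (n + 1)) y) (q - p) :=
    hcont.comp (continuous_par _ _)
  rw [hci, integral_corner_succ hcp]
  have hin : ∀ y : Fin n → ℝ, ∫ t in (0 : ℝ)..(1 - ∑ i, y i),
      fderiv ℝ φ (par p (Fin.cons q w : Fin (n + 1) → E (n + 1)) (Fin.cons t y)) (q - p)
        = φ (par q w y) - φ (par p w y) := by
    intro y
    have hd : ∀ t : ℝ, HasDerivAt (fun t : ℝ => φ (par p w y + t • (q - p)))
        (fderiv ℝ φ (par p w y + t • (q - p)) (q - p)) t := by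
      intro t
      have h1 : HasDerivAt (fun t : ℝ => par p w y + t • (q - p)) (q - p) t := by
        simpa using ((hasDerivAt_id t).smul_const (q - p)).const_add (par p w y)
      exact ((hφ.differentiable one_ne_zero _).hasFDerivAt).comp_hasDerivAt t h1
    simp only [par_cons]
    rw [intervalIntegral.integral_eq_sub_of_hasDerivAt (fun t _ => hd t), par_add_smul]
    · simp
    · exact (hcont.comp (by fun_prop)).intervalIntegrable _ _
  have hint : ∀ r : E (n + 1), IntegrableOn (fun y => φ (par r w y)) (corner n) := fun r =>
    (hφ.continuous.comp (continuous_par r w)).continuousOn.integrableOn_compact (isCompact_corner n)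
  simp only [hin]
  rw [integral_sub (hint q) (hint p)]
  field_simp
  ring

open scoped ENNReal in
/-- The trace inequality on a simplex of codimension one, for functions with compact support. -/
lemma exists_lintegral_face_le
    (h : LinearIndependent ℝ fun i => (Fin.cons q w : Fin (n + 1) → E (n + 1)) i - p) :
    ∃ C : ℝ≥0∞, C ≠ ⊤ ∧ ∀ φ : E (n + 1) → ℝ, ContDiff ℝ 1 φ → HasCompactSupport φ →
      ∫⁻ x in convexHull ℝ (insert p (range w)), ‖φ x‖ₑ ∂(Measure.euclideanHausdorffMeasure n) ≤
        C * ∫⁻ x, ‖fderiv ℝ φ x‖ₑ := by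
  obtain ⟨hp, -⟩ := linearIndependent_cons_swap h
  obtain ⟨c, hc0, hct, hc⟩ := exists_hausdorff_eq_smul_map h
  obtain ⟨b, hb0, hbt, hb⟩ := exists_restrict_simplex_eq hp
  rw [EuclideanSpace.euclideanHausdorffMeasure_eq_volume] at hc
  -- The factor `b` parametrizes the face, `c⁻¹` undoes the parametrization of full dimension, and
  -- `‖q - p‖` bounds the directional derivative.
  refine ⟨b * (‖q - p‖ₑ * c⁻¹), by finiteness, fun φ hφ hs => ?_⟩
  rw [hb, lintegral_smul_measure, (measurableEmbedding_par hp).lintegral_map, smul_eq_mul,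
    mul_assoc]
  gcongr
  set P := par p (Fin.cons q w : Fin (n + 1) → E (n + 1)) with hP
  have hqp : q - p ≠ 0 := by simpa using h.ne_zero 0
  have key : ∀ y : Fin n → ℝ, ‖φ (par p w y)‖ₑ ≤
      ∫⁻ t : ℝ, ‖q - p‖ₑ * ‖fderiv ℝ φ (P (Fin.cons t y))‖ₑ := by
    intro y
    set g : ℝ → ℝ := fun t => φ (par p w y + t • (q - p)) with hg
    have hg1 : ContDiff ℝ 1 g := hφ.comp (by fun_prop)
    have hg2 : HasCompactSupport g := by
      refine hs.comp_isClosedEmbedding (g := fun t : ℝ => par p w y + t • (q - p)) ?_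
      exact (Homeomorph.addLeft (par p w y)).isClosedEmbedding.comp
        (isClosedEmbedding_smul_left hqp)
    have hd : ∀ t : ℝ, deriv g t = fderiv ℝ φ (P (Fin.cons t y)) (q - p) := by
      intro t
      have h1 : HasDerivAt (fun t : ℝ => par p w y + t • (q - p)) (q - p) t := by
        simpa using ((hasDerivAt_id t).smul_const (q - p)).const_add (par p w y)
      rw [hP, par_cons]
      exact (((hφ.differentiable one_ne_zero _).hasFDerivAt).comp_hasDerivAt t h1).deriv
    -- By compact support, the value at the start of a half-line is controlled by the integral of
    -- the derivative along it.
    have h0 := HasCompactSupport.enorm_le_lintegral_Ici_deriv hg1 hg2 0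
    simp only [hg, zero_smul, add_zero] at h0
    refine h0.trans ((setLIntegral_le_lintegral _ _).trans (lintegral_mono fun t => ?_))
    have : deriv (fun t : ℝ => φ (par p w y + t • (q - p))) t = _ := hd t
    rw [this, mul_comm]
    exact ContinuousLinearMap.le_opENorm _ _
  have hmeas : Measurable fun x => ‖fderiv ℝ φ x‖ₑ :=
    ((hφ.continuous_fderiv one_ne_zero).enorm).measurable
  have hmP : Measurable fun z : ℝ × (Fin n → ℝ) => ‖fderiv ℝ φ (P (Fin.cons z.1 z.2))‖ₑ :=
    hmeas.comp ((continuous_par _ _).measurable.comp (measurePreserving_cons n).measurable)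
  calc ∫⁻ y in corner n, ‖φ (par p w y)‖ₑ
      ≤ ∫⁻ y, ∫⁻ t : ℝ, ‖q - p‖ₑ * ‖fderiv ℝ φ (P (Fin.cons t y))‖ₑ :=
        (setLIntegral_le_lintegral _ _).trans (lintegral_mono key)
    _ = ∫⁻ z : ℝ × (Fin n → ℝ), ‖q - p‖ₑ * ‖fderiv ℝ φ (P (Fin.cons z.1 z.2))‖ₑ := by
        rw [Measure.volume_eq_prod, lintegral_prod_symm _ (hmP.const_mul _).aemeasurable]
    _ = ‖q - p‖ₑ * ∫⁻ z, ‖fderiv ℝ φ (P z)‖ₑ := by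
        rw [lintegral_const_mul _ hmP, ← (measurePreserving_cons n).lintegral_comp_emb
          (measurableEmbedding_cons n)]
    _ = ‖q - p‖ₑ * (c⁻¹ * ∫⁻ x in range P, ‖fderiv ℝ φ x‖ₑ) := by
        rw [hc, lintegral_smul_measure, (measurableEmbedding_par h).lintegral_map, smul_eq_mul,
          ← mul_assoc c⁻¹, ENNReal.inv_mul_cancel hc0 hct, one_mul]
    _ ≤ ‖q - p‖ₑ * c⁻¹ * ∫⁻ x, ‖fderiv ℝ φ x‖ₑ := by
        rw [mul_assoc]
        gcongr
        exact Measure.restrict_le_self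

end edges

/-! ### Test functions and `H¹₀` -/

section H10
variable {d : ℕ} {Ω ω : Set (E d)}

lemma IsTest.mono (h : ω ⊆ Ω) {φ : E d → ℝ} (hφ : IsTest ω φ) : IsTest Ω φ :=
  ⟨hφ.1, hφ.2.1, hφ.2.2.trans h⟩

lemma IsTest.contDiff_one {φ : E d → ℝ} (hφ : IsTest ω φ) : ContDiff ℝ 1 φ :=
  hφ.1.of_le (by exact_mod_cast le_top)

lemma IsTest.eq_zero {φ : E d → ℝ} (hφ : IsTest ω φ) {x : E d} (hx : x ∉ ω) : φ x = 0 :=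
  image_eq_zero_of_notMem_tsupport fun h => hx (hφ.2.2 h)

lemma inner_gradient {φ : E d → ℝ} (x e : E d) : ⟪gradient φ x, e⟫ = fderiv ℝ φ x e := by
  simp [gradient]

lemma norm_gradient (φ : E d → ℝ) (x : E d) : ‖gradient φ x‖ = ‖fderiv ℝ φ x‖ := by
  simp [gradient]

lemma continuous_gradient {φ : E d → ℝ} (hφ : ContDiff ℝ 1 φ) : Continuous (gradient φ) :=
  (InnerProductSpace.toDual ℝ (E d)).symm.continuous.comp (hφ.continuous_fderiv one_ne_zero)

lemma hasCompactSupport_gradient {φ : E d → ℝ} (hφ : HasCompactSupport φ) :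
    HasCompactSupport (gradient φ) :=
  (hφ.fderiv ℝ).comp_left (map_zero _)

lemma IsTest.gradient_eq_zero {φ : E d → ℝ} (hφ : IsTest ω φ) {x : E d} (hx : x ∉ ω) :
    gradient φ x = 0 := by
  have h : fderiv ℝ φ x = 0 :=
    image_eq_zero_of_notMem_tsupport fun h => hx (hφ.2.2 (tsupport_fderiv_subset ℝ h))
  simp [gradient, h]

lemma IsTest.memLp {φ : E d → ℝ} (hφ : IsTest ω φ) : MemLp φ 2 (volume : Measure (E d)) :=
  hφ.1.continuous.memLp_of_hasCompactSupport hφ.2.1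

lemma IsTest.memLp_gradient {φ : E d → ℝ} (hφ : IsTest ω φ) :
    MemLp (gradient φ) 2 (volume : Measure (E d)) :=
  (continuous_gradient hφ.contDiff_one).memLp_of_hasCompactSupport
    (hasCompactSupport_gradient hφ.2.1)

lemma IsTest.exists_isPairOf {φ : E d → ℝ} (hφ : IsTest ω φ) : ∃ p : Pairs d, IsPairOf p φ :=
  ⟨(hφ.memLp.toLp, hφ.memLp_gradient.toLp), hφ.memLp.coeFn_toLp, hφ.memLp_gradient.coeFn_toLp⟩

lemma testPairs_mono (h : ω ⊆ Ω) : testPairs ω ≤ testPairs Ω := by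
  rintro p ⟨φ, hφ, hp⟩
  exact ⟨φ, hφ.mono h, hp⟩

lemma H10_mono (h : ω ⊆ Ω) : H10 ω ≤ H10 Ω :=
  Submodule.topologicalClosure_mono (testPairs_mono h)

lemma testPairs_le_H10 : testPairs ω ≤ H10 ω := Submodule.le_topologicalClosure _

/-- Continuous linear maps on `H¹₀(Ω)` that agree on test functions of `ω` agree on `H¹₀(ω)`. -/
lemma eq_of_eq_on_tests {G : Type*} [NormedAddCommGroup G] [NormedSpace ℝ G] (h : ω ⊆ Ω)
    (ℓ₁ ℓ₂ : H10 Ω →L[ℝ] G)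
    (he : ∀ φ, IsTest ω φ → ∀ v : H10 Ω, IsPairOf (v : Pairs d) φ → ℓ₁ v = ℓ₂ v)
    (v : H10 Ω) (hv : (v : Pairs d) ∈ H10 ω) : ℓ₁ v = ℓ₂ v := by
  have hv' : (v : Pairs d) ∈ closure (testPairs ω : Set (Pairs d)) := hv
  obtain ⟨p, hp, hlim⟩ := mem_closure_iff_seq_limit.1 hv'
  let u : ℕ → H10 Ω := fun k => ⟨p k, H10_mono h (testPairs_le_H10 (hp k))⟩
  have hu : Filter.Tendsto u Filter.atTop (nhds v) := tendsto_subtype_rng.2 hlim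
  have h1 := (ℓ₁.continuous.tendsto v).comp hu
  have h2 := (ℓ₂.continuous.tendsto v).comp hu
  refine tendsto_nhds_unique h1 (h2.congr fun k => ?_)
  obtain ⟨φ, hφ, hk⟩ := hp k
  exact (he φ hφ (u k) hk).symm

lemma ext_of_eq_on_tests {G : Type*} [NormedAddCommGroup G] [NormedSpace ℝ G]
    {ℓ₁ ℓ₂ : H10 Ω →L[ℝ] G}
    (he : ∀ φ, IsTest Ω φ → ∀ v : H10 Ω, IsPairOf (v : Pairs d) φ → ℓ₁ v = ℓ₂ v) : ℓ₁ = ℓ₂ :=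
  ContinuousLinearMap.ext fun v => eq_of_eq_on_tests subset_rfl ℓ₁ ℓ₂ he v v.2

/-- The defining property of the weak gradient. -/
lemma integral_fn_mul_fderiv (v : H10 Ω) {η : E d → ℝ} (hη : IsTest univ η) (e : E d) :
    ∫ x, fn v x * fderiv ℝ η x e = -∫ x, η x * ⟪grad v x, e⟫ := by
  have hc1 : Continuous fun x => fderiv ℝ η x e :=
    (hη.contDiff_one.continuous_fderiv one_ne_zero).clm_apply continuous_const
  have hs1 : HasCompactSupport fun x => fderiv ℝ η x e :=
    (hη.2.1.fderiv ℝ).comp_left (g := fun L : E d →L[ℝ] ℝ => L e) rfl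
  have m1 : MemLp (fun x => fderiv ℝ η x e) 2 (volume : Measure (E d)) :=
    hc1.memLp_of_hasCompactSupport hs1
  have hc2 : Continuous fun x => η x • e := hη.1.continuous.smul continuous_const
  have m2 : MemLp (fun x => η x • e) 2 (volume : Measure (E d)) :=
    hc2.memLp_of_hasCompactSupport (hη.2.1.smul_right (f' := fun _ => e))
  have e1 : ∀ v : H10 Ω, (innerSL ℝ m1.toLp).comp (fnL Ω) v = ∫ x, fn v x * fderiv ℝ η x e := by
    intro v
    change ⟪m1.toLp, fn v⟫ = _
    rw [L2.inner_def]
    refine integral_congr_ae ?_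
    filter_upwards [m1.coeFn_toLp] with x hx
    rw [hx]
    simp
  have e2 : ∀ v : H10 Ω, (innerSL ℝ m2.toLp).comp (gradL Ω) v = ∫ x, η x * ⟪grad v x, e⟫ := by
    intro v
    change ⟪m2.toLp, grad v⟫ = _
    rw [L2.inner_def]
    refine integral_congr_ae ?_
    filter_upwards [m2.coeFn_toLp] with x hx
    rw [hx, inner_smul_left, real_inner_comm]
    simp
  -- Both sides are continuous in `v`, so integrating by parts for test functions suffices.
  suffices h : (innerSL ℝ m1.toLp).comp (fnL Ω) = -(innerSL ℝ m2.toLp).comp (gradL Ω) by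
    rw [← e1, ← e2, h]
    rfl
  refine ext_of_eq_on_tests fun φ hφ u hu => ?_
  change _ = -((innerSL ℝ m2.toLp).comp (gradL Ω) u)
  rw [e1, e2]
  have i1 : ∫ x, fn u x * fderiv ℝ η x e = ∫ x, φ x * fderiv ℝ η x e := by
    refine integral_congr_ae ?_
    filter_upwards [hu.1] with x hx
    rw [← hx]; rfl
  have i2 : ∫ x, η x * ⟪grad u x, e⟫ = ∫ x, fderiv ℝ φ x e * η x := by
    refine integral_congr_ae ?_
    filter_upwards [hu.2] with x hx
    rw [← inner_gradient, ← hx, mul_comm]; rfl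
  rw [i1, i2]
  have hc3 : Continuous fun x => fderiv ℝ φ x e :=
    (hφ.contDiff_one.continuous_fderiv one_ne_zero).clm_apply continuous_const
  refine integral_mul_fderiv_eq_neg_fderiv_mul_of_integrable ?_ ?_ ?_ ?_ ?_
  · exact (hc3.mul hη.1.continuous).integrable_of_hasCompactSupport hη.2.1.mul_left
  · exact (hφ.1.continuous.mul hc1).integrable_of_hasCompactSupport hφ.2.1.mul_right
  · exact (hφ.1.continuous.mul hη.1.continuous).integrable_of_hasCompactSupport hφ.2.1.mul_right
  · exact fun x _ => hφ.contDiff_one.differentiable one_ne_zero x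
  · exact fun x _ => hη.contDiff_one.differentiable one_ne_zero x

/-- Where an element of `H¹₀` is continuously differentiable, its weak gradient is the gradient. -/
lemma grad_ae_eq_gradient {U : Set (E d)} (hU : IsOpen U) {a : E d → ℝ} (ha : ContDiff ℝ 1 a)
    (v : H10 Ω) (hv : ∀ᵐ x, x ∈ U → fn v x = a x) :
    ∀ᵐ x, x ∈ U → grad v x = gradient a x := by
  have hL : LocallyIntegrable (grad v : E d → E d) := (Lp.memLp (grad v)).locallyIntegrable (by norm_num)
  have hG : LocallyIntegrable (gradient a) := (continuous_gradient ha).locallyIntegrable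
  -- Fundamental lemma of the calculus of variations on `U`: it remains to test the difference of
  -- the gradients with `η` supported in `U`.
  have key := hU.ae_eq_zero_of_integral_contDiff_smul_eq_zero (μ := (volume : Measure (E d)))
    (f := fun x => grad v x - gradient a x) ((hL.sub hG).locallyIntegrableOn U) ?_
  · filter_upwards [key] with x hx hxU
    exact sub_eq_zero.1 (hx hxU)
  intro η h1 h2 h3
  have hη : IsTest univ η := ⟨h1, h2, subset_univ _⟩
  have hi1 : Integrable fun x => η x • grad v x :=
    hL.integrable_smul_left_of_hasCompactSupport h1.continuous h2
  have hi2 : Integrable fun x => η x • gradient a x :=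
    hG.integrable_smul_left_of_hasCompactSupport h1.continuous h2
  simp only [smul_sub]
  refine ext_inner_right ℝ fun e => ?_
  have hi : ∀ f : E d → E d, Integrable f → ⟪∫ x, f x, e⟫ = ∫ x, ⟪f x, e⟫ := by
    intro f hf
    rw [real_inner_comm, ← integral_inner hf e]
    simp only [real_inner_comm]
  rw [integral_sub hi1 hi2, inner_sub_left, inner_zero_left, hi _ hi1, hi _ hi2]
  simp only [inner_smul_left, inner_gradient, conj_trivial]
  have e1 := integral_fn_mul_fderiv v hη e
  have e2 : ∫ x, fn v x * fderiv ℝ η x e = ∫ x, a x * fderiv ℝ η x e := by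
    refine integral_congr_ae ?_
    filter_upwards [hv] with x hx
    by_cases hxU : x ∈ U
    · rw [hx hxU]
    · have : fderiv ℝ η x = 0 :=
        image_eq_zero_of_notMem_tsupport fun h => hxU (h3 (tsupport_fderiv_subset ℝ h))
      simp [this]
  have hc1 : Continuous fun x => fderiv ℝ η x e :=
    (hη.contDiff_one.continuous_fderiv one_ne_zero).clm_apply continuous_const
  have hs1 : HasCompactSupport fun x => fderiv ℝ η x e :=
    (hη.2.1.fderiv ℝ).comp_left (g := fun L : E d →L[ℝ] ℝ => L e) rfl
  have hc3 : Continuous fun x => fderiv ℝ a x e :=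
    (ha.continuous_fderiv one_ne_zero).clm_apply continuous_const
  have e3 : ∫ x, a x * fderiv ℝ η x e = -∫ x, fderiv ℝ a x e * η x := by
    refine integral_mul_fderiv_eq_neg_fderiv_mul_of_integrable ?_ ?_ ?_ ?_ ?_
    · exact (hc3.mul h1.continuous).integrable_of_hasCompactSupport h2.mul_left
    · exact (ha.continuous.mul hc1).integrable_of_hasCompactSupport hs1.mul_left
    · exact (ha.continuous.mul h1.continuous).integrable_of_hasCompactSupport h2.mul_left
    · exact fun x _ => ha.differentiable one_ne_zero x
    · exact fun x _ => hη.contDiff_one.differentiable one_ne_zero x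
  simp only [mul_comm (fderiv ℝ a _ e)] at e3
  linarith

/-- An element of `H¹₀` is determined by its underlying function. -/
lemma fn_injective : Function.Injective (fn : H10 Ω → Lp ℝ 2 (volume : Measure (E d))) := by
  intro v w hvw
  have h0 : fn (v - w) = 0 := by
    change v.1.1 - w.1.1 = 0
    exact sub_eq_zero.2 hvw
  -- Elements are pairs, so the second component must be recovered: a vanishing function has a
  -- vanishing weak gradient.
  have h := grad_ae_eq_gradient (a := fun _ => 0) isOpen_univ contDiff_const (v - w) (by
    rw [h0]
    simp)
  have h2 : grad (v - w) = 0 := by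
    refine Lp.ext ?_
    filter_upwards [h, Lp.coeFn_zero (E d) 2 (volume : Measure (E d))] with x hx hx0
    rw [hx (mem_univ x), hx0]
    simp [gradient]
  have h3 : grad v = grad w := sub_eq_zero.1 h2
  exact Subtype.ext (Prod.ext hvw h3)

/-- Injectivity of `fn` makes the choice inside `toH10` irrelevant. -/
lemma toH10_eq {f : E d → ℝ} {v : H10 Ω} (h : (fn v : E d → ℝ) =ᵐ[volume] f) :
    toH10 Ω f = v := by
  have hex : ∃ v : H10 Ω, (fn v : E d → ℝ) =ᵐ[volume] f := ⟨v, h⟩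
  have : toH10 Ω f = hex.choose := dif_pos hex
  rw [this]
  exact fn_injective (Lp.ext (hex.choose_spec.trans h.symm))

/-! ### The trace operator -/

/-- The test functions as a vector space. -/
def testFns (ω : Set (E d)) : Submodule ℝ (E d → ℝ) where
  carrier := {φ | IsTest ω φ}
  zero_mem' := ⟨contDiff_const, HasCompactSupport.zero, by simp⟩
  add_mem' := fun h k =>
    ⟨h.1.add k.1, h.2.1.add k.2.1, (tsupport_add _ _).trans (union_subset h.2.2 k.2.2)⟩
  smul_mem' := fun c φ h =>
    ⟨h.1.const_smul c, h.2.1.smul_left, (tsupport_smul_subset_right (fun _ => c) φ).trans h.2.2⟩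

lemma IsPairOf.eq {p q : Pairs d} {φ : E d → ℝ} (hp : IsPairOf p φ) (hq : IsPairOf q φ) : p = q :=
  Prod.ext (Lp.ext (hp.1.trans hq.1.symm)) (Lp.ext (hp.2.trans hq.2.symm))

/-- The embedding of the test functions into `H¹₀`. -/
def testEmb (Ω : Set (E d)) : testFns Ω →ₗ[ℝ] H10 Ω where
  toFun φ := ⟨φ.2.exists_isPairOf.choose,
    testPairs_le_H10 ⟨φ, φ.2, φ.2.exists_isPairOf.choose_spec⟩⟩
  map_add' φ χ := by
    refine Subtype.ext (IsPairOf.eq (φ + χ).2.exists_isPairOf.choose_spec ?_)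
    have hφ : IsTest Ω (φ : E d → ℝ) := φ.2
    have hχ : IsTest Ω (χ : E d → ℝ) := χ.2
    have h1 := hφ.exists_isPairOf.choose_spec
    have h2 := hχ.exists_isPairOf.choose_spec
    refine ⟨(Lp.coeFn_add _ _).trans (h1.1.add h2.1),
      (Lp.coeFn_add _ _).trans ((h1.2.add h2.2).trans (Filter.Eventually.of_forall fun x => ?_))⟩
    have e := fderiv_add (hφ.1.differentiable (by simp) x) (hχ.1.differentiable (by simp) x)
    simp [gradient, e]
  map_smul' c φ := by
    refine Subtype.ext (IsPairOf.eq (c • φ).2.exists_isPairOf.choose_spec ?_)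
    have hφ : IsTest Ω (φ : E d → ℝ) := φ.2
    have h1 := hφ.exists_isPairOf.choose_spec
    refine ⟨(Lp.coeFn_smul c _).trans (h1.1.const_smul c),
      (Lp.coeFn_smul c _).trans ((h1.2.const_smul c).trans (Filter.Eventually.of_forall fun x => ?_))⟩
    have e := fderiv_const_smul (hφ.1.differentiable (by simp) x) c
    simp [gradient, e]

lemma isPairOf_testEmb (φ : testFns Ω) : IsPairOf (testEmb Ω φ : Pairs d) φ :=
  φ.2.exists_isPairOf.choose_spec

lemma denseRange_testEmb : DenseRange (testEmb Ω) := by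
  intro v
  have hv' : (v : Pairs d) ∈ closure (testPairs Ω : Set (Pairs d)) := v.2
  obtain ⟨p, hp, hlim⟩ := mem_closure_iff_seq_limit.1 hv'
  refine mem_closure_iff_seq_limit.2
    ⟨fun k => ⟨p k, testPairs_le_H10 (hp k)⟩, fun k => ?_, tendsto_subtype_rng.2 hlim⟩
  obtain ⟨φ, hφ, hk⟩ := hp k
  exact ⟨⟨φ, hφ⟩, Subtype.ext ((isPairOf_testEmb ⟨φ, hφ⟩).eq hk)⟩

open scoped ENNReal

lemma IsTest.integrable {φ : E d → ℝ} (hφ : IsTest ω φ) (μ : Measure (E d)) [IsFiniteMeasure μ] :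
    Integrable φ μ :=
  hφ.1.continuous.integrable_of_hasCompactSupport hφ.2.1

/-- A trace inequality for test functions yields a trace operator. -/
lemma exists_isTraceOp_of_bound (hΩb : Bornology.IsBounded Ω) (F : Finset (E d))
    [IsFiniteMeasure (surf F)] {C : ℝ≥0∞} (hC : C ≠ ⊤)
    (h : ∀ φ : E d → ℝ, ContDiff ℝ 1 φ → HasCompactSupport φ →
      ∫⁻ x, ‖φ x‖ₑ ∂(surf F) ≤ C * ∫⁻ x, ‖fderiv ℝ φ x‖ₑ) :
    ∃ T : H10 Ω →L[ℝ] Lp ℝ 1 (surf F), IsTraceOp F T := by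
  have hΩv : volume Ω ≠ ⊤ := hΩb.measure_lt_top.ne
  have hmem : ∀ φ : testFns Ω, MemLp (φ : E d → ℝ) 1 (surf F) := fun φ =>
    memLp_one_iff_integrable.2 (IsTest.integrable φ.2 _)
  let f : testFns Ω →ₗ[ℝ] Lp ℝ 1 (surf F) :=
    { toFun := fun φ => (hmem φ).toLp
      map_add' := fun φ χ => MemLp.toLp_add (hmem φ) (hmem χ)
      map_smul' := fun c φ => MemLp.toLp_const_smul c (hmem φ) }
  -- The factor `|Ω|^(1/2)` is the Hölder constant from `L²` to `L¹` for the gradient, which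
  -- vanishes off `Ω`.
  have hbound : ∀ φ : testFns Ω,
      ‖f φ‖ ≤ (C * volume Ω ^ (1 / 2 : ℝ)).toReal * ‖testEmb Ω φ‖ := by
    intro φ
    have hφ : IsTest Ω (φ : E d → ℝ) := φ.2
    have hCt : C * volume Ω ^ (1 / 2 : ℝ) ≠ ⊤ := by finiteness
    have h1 : ‖f φ‖ₑ ≤ C * volume Ω ^ (1 / 2 : ℝ) * ‖(testEmb Ω φ : Pairs d).2‖ₑ := by
      have e1 : ‖f φ‖ₑ = ∫⁻ x, ‖(φ : E d → ℝ) x‖ₑ ∂(surf F) := by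
        change ‖(hmem φ).toLp‖ₑ = _
        rw [Lp.enorm_toLp, eLpNorm_one_eq_lintegral_enorm]
      rw [e1]
      refine (h φ hφ.contDiff_one hφ.2.1).trans ?_
      rw [mul_assoc]
      gcongr
      have e2 : ∫⁻ x, ‖fderiv ℝ (φ : E d → ℝ) x‖ₑ = ∫⁻ x in Ω, ‖gradient (φ : E d → ℝ) x‖ₑ := by
        have e3 : ∀ x, ‖fderiv ℝ (φ : E d → ℝ) x‖ₑ = ‖gradient (φ : E d → ℝ) x‖ₑ := by
          intro x
          rw [← ofReal_norm, ← ofReal_norm, norm_gradient]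
        simp only [e3]
        rw [setLIntegral_eq_of_support_subset]
        intro x hx
        by_contra hxΩ
        simp [hφ.gradient_eq_zero hxΩ] at hx
      have e4 : ‖(testEmb Ω φ : Pairs d).2‖ₑ = eLpNorm (gradient (φ : E d → ℝ)) 2 volume := by
        rw [Lp.enorm_def, eLpNorm_congr_ae (isPairOf_testEmb φ).2]
      rw [e2, e4, mul_comm, ← eLpNorm_one_eq_lintegral_enorm]
      have e5 := eLpNorm_le_eLpNorm_mul_rpow_measure_univ (p := 1) (q := 2)
        (μ := volume.restrict Ω) (f := gradient (φ : E d → ℝ)) (by norm_num)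
        (continuous_gradient hφ.contDiff_one).aestronglyMeasurable
      refine e5.trans ?_
      rw [Measure.restrict_apply_univ]
      have : (1 / (1 : ℝ≥0∞).toReal - 1 / (2 : ℝ≥0∞).toReal) = (1 / 2 : ℝ) := by norm_num
      rw [this]
      gcongr
      exact Measure.restrict_le_self
    have h2 : ‖(testEmb Ω φ : Pairs d).2‖ ≤ ‖testEmb Ω φ‖ := le_max_right _ _
    have h3 := (ENNReal.toReal_le_toReal (by finiteness) (by finiteness)).2 h1
    rw [ENNReal.toReal_mul (a := C * volume Ω ^ (1 / 2 : ℝ)), toReal_enorm, toReal_enorm] at h3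
    exact h3.trans (by gcongr)
  refine ⟨f.extendOfNorm (testEmb Ω), fun φ hφ v hv => ?_⟩
  have e1 : v = testEmb Ω ⟨φ, hφ⟩ := Subtype.ext (hv.eq (isPairOf_testEmb ⟨φ, hφ⟩))
  rw [e1, LinearMap.extendOfNorm_eq denseRange_testEmb ⟨_, hbound⟩]
  exact (hmem ⟨φ, hφ⟩).coeFn_toLp

end H10

/-! ### Lipschitz functions with zero boundary values belong to `H¹₀` -/

/-- In a decreasing sequence of convex sets with elements of bounded image in an inner product
space, one can select elements whose images form a Cauchy sequence. -/
lemma exists_cauchySeq_of_antitone_convex {V H : Type*} [AddCommGroup V] [Module ℝ V]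
    [NormedAddCommGroup H] [InnerProductSpace ℝ H] (D : V →ₗ[ℝ] H) {C : ℕ → Set V}
    (hanti : Antitone C) (hconv : ∀ n, Convex ℝ (C n)) {B : ℝ}
    (hB : ∀ n, ∃ v ∈ C n, ‖D v‖ ≤ B) :
    ∃ y : ℕ → V, (∀ n, y n ∈ C n) ∧ CauchySeq fun n => D (y n) := by
  -- The infima `δ n` increase to a finite limit. Near-minimizers form a Cauchy sequence by the
  -- parallelogram law, since their midpoint stays in the convex set and so has norm at least `δ N`.
  let δ : ℕ → ℝ := fun n => sInf ((fun v => ‖D v‖) '' C n)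
  have hbdd : ∀ n, BddBelow ((fun v => ‖D v‖) '' C n) := fun n =>
    ⟨0, by rintro _ ⟨v, -, rfl⟩; exact norm_nonneg _⟩
  have hne : ∀ n, ((fun v => ‖D v‖) '' C n).Nonempty := fun n => by
    obtain ⟨v, hv, -⟩ := hB n
    exact ⟨_, mem_image_of_mem _ hv⟩
  have hle : ∀ n, ∀ v ∈ C n, δ n ≤ ‖D v‖ := fun n v hv => csInf_le (hbdd n) (mem_image_of_mem _ hv)
  have h0 : ∀ n, 0 ≤ δ n := fun n => le_csInf (hne n) (by rintro _ ⟨v, -, rfl⟩; exact norm_nonneg _)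
  have hmono : Monotone δ := fun m n hmn =>
    csInf_le_csInf (hbdd m) (hne n) (image_mono (hanti hmn))
  have hδB : BddAbove (range δ) := ⟨B, by
    rintro _ ⟨n, rfl⟩
    obtain ⟨v, hv, hvB⟩ := hB n
    exact (hle n v hv).trans hvB⟩
  have hlim := tendsto_atTop_ciSup hmono hδB
  set δ' := ⨆ n, δ n
  have hδ' : ∀ n, δ n ≤ δ' := fun n => le_ciSup hδB n
  have hy : ∀ n : ℕ, ∃ v ∈ C n, ‖D v‖ < δ n + 1 / (n + 1) := fun n => by
    obtain ⟨_, ⟨v, hv, rfl⟩, h⟩ := exists_lt_of_csInf_lt (hne n)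
      (lt_add_of_pos_right (δ n) (Nat.one_div_pos_of_nat (n := n)))
    exact ⟨v, hv, h⟩
  choose y hyC hyn using hy
  have hone : Filter.Tendsto (fun n : ℕ => 1 / ((n : ℝ) + 1)) Filter.atTop (nhds 0) :=
    tendsto_one_div_add_atTop_nhds_zero_nat
  refine ⟨y, hyC, cauchySeq_of_le_tendsto_0
    (fun N : ℕ => √(4 * (δ' + 1 / (N + 1)) ^ 2 - 4 * δ N ^ 2)) (fun n m N hn hm => ?_) ?_⟩
  · rw [dist_eq_norm]
    refine Real.le_sqrt_of_sq_le ?_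
    have hb : ∀ k, N ≤ k → ‖D (y k)‖ ≤ δ' + 1 / (N + 1) := fun k hk => by
      have h1 : 1 / ((k : ℝ) + 1) ≤ 1 / (N + 1) := by gcongr
      linarith [hyn k, hδ' k]
    have hmid := hconv N (hanti hn (hyC n)) (hanti hm (hyC m)) (a := 1 / 2) (b := 1 / 2)
      (by norm_num) (by norm_num) (by norm_num)
    have h1 := hle N _ hmid
    rw [← smul_add, map_smul, norm_smul, map_add, Real.norm_of_nonneg (by norm_num)] at h1
    have h2 := parallelogram_law_with_norm ℝ (D (y n)) (D (y m))
    have h3 := hb n hn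
    have h4 := hb m hm
    have h5 : (2 * δ N) ^ 2 ≤ ‖D (y n) + D (y m)‖ ^ 2 :=
      pow_le_pow_left₀ (by linarith [h0 N]) (by linarith) 2
    have h6 := pow_le_pow_left₀ (norm_nonneg _) h3 2
    have h7 := pow_le_pow_left₀ (norm_nonneg _) h4 2
    nlinarith
  · have h1 : Filter.Tendsto (fun N : ℕ => 4 * (δ' + 1 / ((N : ℝ) + 1)) ^ 2 - 4 * δ N ^ 2)
        Filter.atTop (nhds (4 * (δ' + 0) ^ 2 - 4 * δ' ^ 2)) :=
      (((hone.const_add δ').pow 2).const_mul 4).sub ((hlim.pow 2).const_mul 4)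
    have h2 := (Real.continuous_sqrt.tendsto _).comp h1
    simpa [Function.comp_def] using h2

section lipschitz
variable {d : ℕ} {Ω ω : Set (E d)}

open scoped NNReal Convolution in
/-- A Lipschitz function that vanishes off a bounded open set is approximated uniformly by test
functions with the same Lipschitz constant (up to a factor). -/
lemma exists_isTest_near {f : E d → ℝ} {L : ℝ≥0} (hω : IsOpen ω) (hb : Bornology.IsBounded ω)
    (hf : LipschitzWith L f) (h0 : ∀ x, x ∉ ω → f x = 0) {ε : ℝ} (hε : 0 < ε) :
    ∃ φ, IsTest ω φ ∧ (∀ x, |φ x - f x| ≤ ε) ∧ ∀ x, ‖fderiv ℝ φ x‖ ≤ (L + L : ℝ≥0) := by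
  set e := ε / 2 with he
  have hepos : 0 < e := by positivity
  -- Subtracting the truncation of `f` to `[-e, e]` moves `f` by at most `e` and makes it vanish
  -- where `|f| < e`, so the support becomes compact inside `ω`.
  let g : E d → ℝ := fun x => f x - max (min (f x) e) (-e)
  have hg : LipschitzWith (L + L) g := hf.sub ((hf.min_const e).max_const (-e))
  have hgf : ∀ x, |g x - f x| ≤ e := fun x => by
    simp only [g, sub_sub_cancel_left, abs_neg]
    refine abs_le.2 ⟨le_max_right _ _, max_le (min_le_right _ _) (by linarith)⟩
  let S : Set (E d) := {x | e ≤ |f x|}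
  have hSω : S ⊆ ω := fun x hx => by
    by_contra hxω
    have hx' : e ≤ |f x| := hx
    rw [h0 x hxω, abs_zero] at hx'
    linarith
  have hSc : IsClosed S := isClosed_le continuous_const hf.continuous.abs
  have hSk : IsCompact S := Metric.isCompact_of_isClosed_isBounded hSc (hb.subset hSω)
  have hgS : ∀ x, x ∉ S → g x = 0 := fun x hx => by
    have hx' : |f x| < e := not_le.1 hx
    rw [abs_lt] at hx'
    simp only [g]
    rw [min_eq_left hx'.2.le, max_eq_left hx'.1.le, sub_self]
  have hgsupp : Function.support g ⊆ S := fun x hx => by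
    by_contra h
    exact hx (hgS x h)
  have hgk : HasCompactSupport g := HasCompactSupport.intro hSk hgS
  obtain ⟨δ, hδ, hδω⟩ := hSk.exists_cthickening_subset_open hω hSω
  -- Mollification radius: `δ` keeps the support in `ω`, the second bound keeps the error below `e`,
  -- and the summand `1` covers `L = 0`.
  set r : ℝ := min δ (e / (2 * L + 1)) with hr
  have hL : (0 : ℝ) < 2 * L + 1 := by positivity
  have hrpos : 0 < r := lt_min hδ (by positivity)
  let ρ : ContDiffBump (0 : E d) := ⟨r / 2, r, by positivity, by linarith⟩
  have hgi : LocallyIntegrable g (volume : Measure (E d)) := hg.continuous.locallyIntegrable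
  let φ : E d → ℝ := ρ.normed volume ⋆[ContinuousLinearMap.lsmul ℝ ℝ, volume] g
  have hφ : ContDiff ℝ (⊤ : ℕ∞) φ :=
    ρ.hasCompactSupport_normed.contDiff_convolution_left _ ρ.contDiff_normed hgi
  have hsupp : tsupport φ ⊆ Metric.cthickening δ S := by
    refine closure_minimal ((support_convolution_subset _).trans ?_) Metric.isClosed_cthickening
    rintro _ ⟨a, ha, b, hb, rfl⟩
    rw [ρ.support_normed_eq, mem_ball_zero_iff] at ha
    refine Metric.mem_cthickening_of_dist_le _ b δ S (hgsupp hb) ?_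
    rw [dist_eq_norm, add_sub_cancel_right]
    exact ha.le.trans (min_le_left _ _)
  have hcs : HasCompactSupport φ := hSk.cthickening.of_isClosed_subset (isClosed_tsupport _) hsupp
  have hlip : LipschitzWith (L + L) φ := by
    refine LipschitzWith.of_dist_le_mul fun x y => ?_
    have hex : ∀ z, Integrable (fun t => ρ.normed volume t • g (z - t)) := fun z =>
      (ρ.continuous_normed.smul (hg.continuous.comp (by fun_prop))).integrable_of_hasCompactSupport
        ρ.hasCompactSupport_normed.smul_right
    have e1 : φ x - φ y = ∫ t, ρ.normed volume t • (g (x - t) - g (y - t)) := by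
      simp only [smul_sub]
      rw [integral_sub (hex x) (hex y)]
      rfl
    rw [dist_eq_norm, e1]
    have hint : Integrable fun t => ρ.normed volume t * ((L + L : ℝ≥0) * dist x y) :=
      ρ.integrable_normed.mul_const _
    refine (norm_integral_le_of_norm_le hint (Filter.Eventually.of_forall fun t => ?_)).trans ?_
    · rw [norm_smul, Real.norm_of_nonneg (ρ.nonneg_normed t)]
      refine mul_le_mul_of_nonneg_left ?_ (ρ.nonneg_normed t)
      have := hg.dist_le_mul (x - t) (y - t)
      rwa [dist_sub_right, dist_eq_norm] at this
    · rw [integral_mul_const, ρ.integral_normed, one_mul]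
  refine ⟨φ, ⟨hφ, hcs, hsupp.trans hδω⟩, fun x => ?_,
    fun x => norm_fderiv_le_of_lipschitz ℝ hlip⟩
  have h1 : dist (φ x) (g x) ≤ e := by
    refine ρ.dist_normed_convolution_le hg.continuous.aestronglyMeasurable fun y hy => ?_
    refine (hg.dist_le_mul y x).trans ?_
    have h2 : dist y x ≤ e / (2 * L + 1) := (Metric.mem_ball.1 hy).le.trans (min_le_right _ _)
    rw [le_div_iff₀ hL] at h2
    push_cast
    nlinarith [dist_nonneg (x := y) (y := x)]
  rw [Real.dist_eq] at h1
  have h3 := abs_sub_le (φ x) (g x) (f x)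
  linarith [hgf x]

lemma hasCompactSupport_of_eq_zero {f : E d → ℝ} (hb : Bornology.IsBounded ω)
    (h0 : ∀ x, x ∉ ω → f x = 0) : HasCompactSupport f :=
  HasCompactSupport.intro hb.isCompact_closure fun x hx => h0 x fun h => hx (subset_closure h)

open scoped NNReal in
/-- Lipschitz functions vanishing off a bounded open set belong to `H¹₀`, with approximating test
functions that also converge uniformly. -/
lemma exists_H10_of_lipschitz {f : E d → ℝ} {L : ℝ≥0} (hω : IsOpen ω)
    (hb : Bornology.IsBounded ω) (hf : LipschitzWith L f) (h0 : ∀ x, x ∉ ω → f x = 0) :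
    ∃ v : H10 ω, (fn v : E d → ℝ) =ᵐ[volume] f ∧ ∃ y : ℕ → testFns ω,
      Filter.Tendsto (fun n => testEmb ω (y n)) Filter.atTop (nhds v) ∧
      ∀ (n : ℕ) (x : E d), |(y n : E d → ℝ) x - f x| ≤ 1 / (n + 1) := by
  have hωm := hω.measurableSet
  have hωv : volume ω ≠ ⊤ := hb.measure_lt_top.ne
  -- Uniform neighbourhoods of `f` are convex, decreasing, and contain test functions with bounded
  -- gradients. Selecting from them gives uniform convergence to `f` together with strong `L²`
  -- convergence of the gradients.
  let C : ℕ → Set (testFns ω) := fun n => {φ | ∀ x, |(φ : E d → ℝ) x - f x| ≤ 1 / (n + 1)}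
  let D : testFns ω →ₗ[ℝ] Lp (E d) 2 (volume : Measure (E d)) := (gradL ω).toLinearMap ∘ₗ testEmb ω
  have hanti : Antitone C := fun m n hmn φ hφ x => (hφ x).trans (by gcongr)
  have hconv : ∀ n, Convex ℝ (C n) := by
    intro n φ hφ χ hχ a b ha hb hab x
    have e : ((a • φ + b • χ : testFns ω) : E d → ℝ) x - f x
        = a * ((φ : E d → ℝ) x - f x) + b * ((χ : E d → ℝ) x - f x) := by
      have : f x = (a + b) * f x := by rw [hab, one_mul]
      simp only [Submodule.coe_add, Submodule.coe_smul, Pi.add_apply, Pi.smul_apply, smul_eq_mul]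
      linear_combination -this
    rw [e]
    refine (abs_add_le _ _).trans ?_
    rw [abs_mul, abs_mul, abs_of_nonneg ha, abs_of_nonneg hb]
    have h1 := mul_le_mul_of_nonneg_left (hφ x) ha
    have h2 := mul_le_mul_of_nonneg_left (hχ x) hb
    have h3 : (1 : ℝ) / (n + 1) = a * (1 / (n + 1)) + b * (1 / (n + 1)) := by
      rw [← add_mul, hab, one_mul]
    linarith
  have hB : ∀ n, ∃ φ ∈ C n, ‖D φ‖ ≤ ‖indicatorConstLp 2 hωm hωv ((L + L : ℝ≥0) : ℝ)‖ := by
    intro n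
    obtain ⟨φ, hφ, hφf, hφd⟩ := exists_isTest_near hω hb hf h0
      (Nat.one_div_pos_of_nat (n := n) (α := ℝ))
    refine ⟨⟨φ, hφ⟩, hφf, Lp.norm_le_norm_of_ae_le ?_⟩
    have h1 := (isPairOf_testEmb (⟨φ, hφ⟩ : testFns ω)).2
    filter_upwards [h1, indicatorConstLp_coeFn (p := 2) (hs := hωm) (hμs := hωv)
      (c := ((L + L : ℝ≥0) : ℝ))] with x hx hx2
    have hx' : (D ⟨φ, hφ⟩) x = gradient φ x := hx
    rw [hx', hx2]
    by_cases hxω : x ∈ ω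
    · rw [indicator_of_mem hxω, norm_gradient, NNReal.norm_eq]
      exact hφd x
    · simp [hφ.gradient_eq_zero hxω]
  obtain ⟨y, hyC, hyD⟩ := exists_cauchySeq_of_antitone_convex D hanti hconv hB
  obtain ⟨G, hG⟩ := cauchySeq_tendsto_of_complete hyD
  have hfk : HasCompactSupport f := hasCompactSupport_of_eq_zero hb h0
  have hfL : MemLp f 2 (volume : Measure (E d)) :=
    hf.continuous.memLp_of_hasCompactSupport hfk
  have hfn : Filter.Tendsto (fun n => fn (testEmb ω (y n))) Filter.atTop (nhds hfL.toLp) := by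
    rw [tendsto_iff_norm_sub_tendsto_zero]
    have h1 : ∀ n : ℕ, ‖fn (testEmb ω (y n)) - hfL.toLp‖ ≤
        (1 / ((n : ℝ) + 1)) * (volume.real ω ^ (1 / (2 : ENNReal).toReal)) := by
      intro n
      have e1 : ‖indicatorConstLp 2 hωm hωv (1 / ((n : ℝ) + 1))‖
          = (1 / ((n : ℝ) + 1)) * (volume.real ω ^ (1 / (2 : ENNReal).toReal)) := by
        rw [norm_indicatorConstLp (by norm_num) (by norm_num),
          Real.norm_of_nonneg (by positivity)]
      rw [← e1]
      refine Lp.norm_le_norm_of_ae_le ?_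
      filter_upwards [(isPairOf_testEmb (y n)).1, hfL.coeFn_toLp,
        Lp.coeFn_sub (fn (testEmb ω (y n))) hfL.toLp,
        indicatorConstLp_coeFn (p := 2) (hs := hωm) (hμs := hωv) (c := 1 / ((n : ℝ) + 1))]
        with x h1 h2 h3 h4
      have h1' : fn (testEmb ω (y n)) x = (y n : E d → ℝ) x := h1
      rw [h3, h4, Pi.sub_apply, h1', h2]
      by_cases hxω : x ∈ ω
      · rw [indicator_of_mem hxω, Real.norm_eq_abs, Real.norm_of_nonneg (by positivity)]
        exact hyC n x
      · simp [(y n).2.eq_zero hxω, h0 x hxω]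
    refine squeeze_zero (fun n => norm_nonneg _) h1 ?_
    simpa using (tendsto_one_div_add_atTop_nhds_zero_nat (𝕜 := ℝ)).mul_const
      (volume.real ω ^ (1 / (2 : ENNReal).toReal))
  have hlim : Filter.Tendsto (fun n => (testEmb ω (y n) : Pairs d)) Filter.atTop
      (nhds (hfL.toLp, G)) := hfn.prodMk_nhds hG
  have hmem : ((hfL.toLp, G) : Pairs d) ∈ H10 ω :=
    (testPairs ω).isClosed_topologicalClosure.mem_of_tendsto hlim
      (Filter.Eventually.of_forall fun n => (testEmb ω (y n)).2)
  exact ⟨⟨_, hmem⟩, hfL.coeFn_toLp, y, tendsto_subtype_rng.2 hlim, hyC⟩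

open scoped NNReal in
/-- The trace of a Lipschitz function is its restriction. -/
lemma exists_H10_trace_eq {f : E d → ℝ} {L : ℝ≥0} (hω : IsOpen ω) (hωΩ : ω ⊆ Ω)
    (hb : Bornology.IsBounded ω) (hf : LipschitzWith L f) (h0 : ∀ x, x ∉ ω → f x = 0) :
    ∃ v : H10 Ω, (v : Pairs d) ∈ H10 ω ∧ (fn v : E d → ℝ) =ᵐ[volume] f ∧
      ∀ F : Finset (E d), IsFiniteMeasure (surf F) → ∀ T : H10 Ω →L[ℝ] Lp ℝ 1 (surf F),
        IsTraceOp F T → (T v : E d → ℝ) =ᵐ[surf F] f := by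
  obtain ⟨v, hvf, y, hy, hyf⟩ := exists_H10_of_lipschitz hω hb hf h0
  refine ⟨⟨v, H10_mono hωΩ v.2⟩, v.2, hvf, fun F hF T hT => ?_⟩
  have hfL : MemLp f 1 (surf F) := memLp_one_iff_integrable.2
    (hf.continuous.integrable_of_hasCompactSupport (hasCompactSupport_of_eq_zero hb h0))
  let u : ℕ → H10 Ω := fun n => ⟨testEmb ω (y n), H10_mono hωΩ (testEmb ω (y n)).2⟩
  have hu : Filter.Tendsto u Filter.atTop (nhds ⟨v, H10_mono hωΩ v.2⟩) :=
    tendsto_subtype_rng.2 ((continuous_subtype_val.tendsto v).comp hy)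
  have h1 := (T.continuous.tendsto _).comp hu
  -- The approximants converge uniformly and `F` has finite measure, so their restrictions to `F`
  -- converge to `f` in `L¹(F)`.
  have h2 : Filter.Tendsto (T ∘ u) Filter.atTop (nhds hfL.toLp) := by
    rw [tendsto_iff_norm_sub_tendsto_zero]
    have h3 : ∀ n : ℕ, ‖(T ∘ u) n - hfL.toLp‖ ≤
        (measureUnivNNReal (surf F) : ℝ) ^ (1 : ENNReal).toReal⁻¹ * (1 / ((n : ℝ) + 1)) := by
      intro n
      refine Lp.norm_le_of_ae_bound (by positivity) ?_
      have h4 := hT (y n) ((y n).2.mono hωΩ) (u n) (isPairOf_testEmb (y n))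
      filter_upwards [h4, hfL.coeFn_toLp, Lp.coeFn_sub ((T ∘ u) n) hfL.toLp] with x h1 h2 h3
      have h1' : ((T ∘ u) n) x = (y n : E d → ℝ) x := h1
      rw [h3, Pi.sub_apply, h1', h2]
      exact hyf n x
    refine squeeze_zero (fun n => norm_nonneg _) h3 ?_
    simpa using (tendsto_one_div_add_atTop_nhds_zero_nat (𝕜 := ℝ)).const_mul
      ((measureUnivNNReal (surf F) : ℝ) ^ (1 : ENNReal).toReal⁻¹)
  rw [tendsto_nhds_unique h1 h2]
  exact hfL.coeFn_toLp

end lipschitz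

/-! ### Barycentric coordinates -/

section bary
variable {d : ℕ}

lemma affine_sum_smul {ι : Type*} (s : Finset ι) (w : ι → ℝ) (u : ι → E d) (hw : ∑ i ∈ s, w i = 1)
    (a : E d →ᵃ[ℝ] ℝ) : a (∑ i ∈ s, w i • u i) = ∑ i ∈ s, w i * a (u i) := by
  have h : ∀ x, a x = a.linear x + a 0 := fun x => by
    simpa using a.map_vadd 0 x
  rw [h, map_sum]
  simp only [map_smul, smul_eq_mul]
  have h2 : ∑ i ∈ s, w i * a (u i) = ∑ i ∈ s, (w i * a.linear (u i) + w i * a 0) :=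
    Finset.sum_congr rfl fun i _ => by rw [h (u i)]; ring
  rw [h2, Finset.sum_add_distrib, ← Finset.sum_mul, hw, one_mul]

lemma affine_add_smul_sub (a : E d →ᵃ[ℝ] ℝ) (x y : E d) (t : ℝ) :
    a (x + t • (y - x)) = (1 - t) * a x + t * a y := by
  have h : ∀ x, a x = a.linear x + a 0 := fun x => by
    simpa using a.map_vadd 0 x
  rw [h, h x, h y, map_add, map_smul, map_sub, smul_eq_mul]
  ring

/-- `a z`, `z ∈ K`, are the barycentric coordinates of the simplex `K`. -/
structure IsBary (K : Finset (E d)) (a : E d → E d →ᵃ[ℝ] ℝ) : Prop where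
  apply_self : ∀ z ∈ K, a z z = 1
  apply_ne : ∀ z ∈ K, ∀ y ∈ K, y ≠ z → a z y = 0
  sum_eq_one : ∀ x, ∑ z ∈ K, a z x = 1
  sum_smul : ∀ x, ∑ z ∈ K, a z x • z = x
  mem_hull_iff : ∀ x, x ∈ hull K ↔ ∀ z ∈ K, 0 ≤ a z x
  mem_interior_iff : ∀ x, x ∈ interior (hull K) ↔ ∀ z ∈ K, 0 < a z x

open Classical in
lemma exists_isBary {K : Finset (E d)} (hc : K.card = d + 1)
    (hi : AffineIndependent ℝ ((↑) : K → E d)) : ∃ a, IsBary K a := by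
  have hspan : affineSpan ℝ (range ((↑) : K → E d)) = ⊤ := by
    rw [hi.affineSpan_eq_top_iff_card_eq_finrank_add_one]
    simp [hc]
  let b : AffineBasis K ℝ (E d) := ⟨(↑), hi, hspan⟩
  let a : E d → E d →ᵃ[ℝ] ℝ := fun z => if h : z ∈ K then b.coord ⟨z, h⟩ else 0
  have ha : ∀ z (h : z ∈ K), a z = b.coord ⟨z, h⟩ := fun z h => dif_pos h
  have hb : hull K = convexHull ℝ (range b) := by
    have h : range b = (K : Set (E d)) := Subtype.range_coe
    rw [h]
  refine ⟨a, ?_, ?_, ?_, ?_, ?_, ?_⟩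
  · intro z hz
    rw [ha z hz]
    exact b.coord_apply_eq ⟨z, hz⟩
  · intro z hz y hy hne
    rw [ha z hz]
    refine b.coord_apply_ne (i := ⟨z, hz⟩) (j := ⟨y, hy⟩) ?_
    intro e
    exact hne (congrArg Subtype.val e).symm
  · intro x
    rw [← b.sum_coord_apply_eq_one x, ← Finset.sum_coe_sort]
    exact Finset.sum_congr rfl fun z _ => by rw [ha z z.2]
  · intro x
    conv_rhs => rw [← b.linear_combination_coord_eq_self x]
    rw [← Finset.sum_coe_sort]
    exact Finset.sum_congr rfl fun z _ => by rw [ha z z.2]; rfl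
  · intro x
    rw [hb, b.convexHull_eq_nonneg_coord]
    exact ⟨fun h z hz => by rw [ha z hz]; exact h _, fun h z => by rw [← ha z z.2]; exact h z z.2⟩
  · intro x
    rw [hb, b.interior_convexHull]
    exact ⟨fun h z hz => by rw [ha z hz]; exact h _, fun h z => by rw [← ha z z.2]; exact h z z.2⟩

open Classical in
/-- The barycentric coordinates of a simplex (`0` for degenerate simplices). -/
def bary (K : Finset (E d)) : E d → E d →ᵃ[ℝ] ℝ :=
  if h : ∃ a, IsBary K a then h.choose else 0

namespace IsBary
variable {K : Finset (E d)} {a : E d → E d →ᵃ[ℝ] ℝ} (h : IsBary K a)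
include h

lemma affine_eq (f : E d →ᵃ[ℝ] ℝ) (x : E d) : f x = ∑ z ∈ K, a z x * f z := by
  conv_lhs => rw [← h.sum_smul x]
  exact affine_sum_smul K _ _ (h.sum_eq_one x) f

lemma eq_zero_of_mem_hull {G : Finset (E d)} (hG : G ⊆ K) {x z : E d} (hx : x ∈ hull G)
    (hz : z ∈ K) (hzG : z ∉ G) : a z x = 0 := by
  have hc : Convex ℝ ((a z) ⁻¹' {0}) := (convex_singleton 0).affine_preimage _
  have hs : (G : Set (E d)) ⊆ (a z) ⁻¹' {0} := fun y hy =>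
    h.apply_ne z hz y (hG hy) fun e => hzG (e ▸ hy)
  exact convexHull_min hs hc hx

end IsBary

/-- Vectors from a vertex of a simplex to different other vertices are linearly independent. -/
lemma linearIndependent_sub {K : Finset (E d)} (hi : AffineIndependent ℝ ((↑) : K → E d))
    {p : E d} (hp : p ∈ K) {m : ℕ} {u : Fin m → E d} (hu : Function.Injective u)
    (huK : ∀ i, u i ∈ K) (hup : ∀ i, u i ≠ p) : LinearIndependent ℝ fun i => u i - p := by
  have h := (affineIndependent_iff_linearIndependent_vsub ℝ _ (⟨p, hp⟩ : K)).1 hi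
  have h2 := h.comp (fun i : Fin m => (⟨⟨u i, huK i⟩, fun e => hup i (congrArg Subtype.val e)⟩ :
    {x : K // x ≠ ⟨p, hp⟩})) (fun i j hij => hu (by simpa using hij))
  exact h2

open Classical in
lemma exists_enum (S : Finset (E d)) {m : ℕ} (hm : S.card = m) :
    ∃ u : Fin m → E d, Function.Injective u ∧ Finset.univ.image u = S := by
  let e := S.equivFinOfCardEq hm
  refine ⟨fun i => (e.symm i : E d), fun i j hij => e.symm.injective (Subtype.ext hij), ?_⟩
  ext x
  simp only [Finset.mem_image, Finset.mem_univ, true_and]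
  exact ⟨fun ⟨i, hi⟩ => hi ▸ (e.symm i).2, fun hx => ⟨e ⟨x, hx⟩, by simp⟩⟩

end bary

/-! ### Geometry of meshes -/

namespace Mesh
variable {d : ℕ} {Ω : Set (E d)} (M : Mesh Ω)

variable {M} {K L F G S : Finset (E d)} {x z : E d}

lemma isBary (hK : K ∈ M.elems) : IsBary K (bary K) := by
  have h := exists_isBary (M.card_eq K hK) (M.indep K hK)
  rw [bary, dif_pos h]
  exact h.choose_spec

lemma eq_of_subset (hK : K ∈ M.elems) (hL : L ∈ M.elems) (h : K ⊆ L) : K = L :=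
  Finset.eq_of_subset_of_card_le h (by rw [M.card_eq K hK, M.card_eq L hL])

/-- Both functions are affine on `K` and agree at its vertices. -/
lemma nodal_eq_bary (hK : K ∈ M.elems) (hx : x ∈ hull K) (hz : z ∈ K) :
    M.nodal z x = bary K z x := by
  obtain ⟨⟨-, h1⟩, h2, -⟩ := M.nodal_spec z
  obtain ⟨a, ha⟩ := h1 K hK
  have hB := isBary hK
  rw [ha hx, hB.affine_eq a x, hB.affine_eq (bary K z) x]
  refine Finset.sum_congr rfl fun y hy => ?_
  rw [← ha (subset_convexHull ℝ _ hy)]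
  by_cases e : y = z
  · rw [(h2 y ⟨K, hK, hy⟩).1 e, e, hB.apply_self z hz]
  · rw [(h2 y ⟨K, hK, hy⟩).2 e, hB.apply_ne z hz y hy e]

lemma nodal_eq_zero (hK : K ∈ M.elems) (hG : G ⊆ K) (hx : x ∈ hull G) (hz : z ∉ G) :
    M.nodal z x = 0 := by
  obtain ⟨⟨-, h1⟩, h2, -⟩ := M.nodal_spec z
  obtain ⟨a, ha⟩ := h1 K hK
  rw [ha (convexHull_mono (by exact_mod_cast hG) hx)]
  have hc : Convex ℝ (a ⁻¹' {0}) := (convex_singleton 0).affine_preimage _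
  refine convexHull_min (fun y hy => ?_) hc hx
  have hyK : y ∈ K := hG hy
  have e := ha (subset_convexHull ℝ _ hyK)
  rw [(h2 y ⟨K, hK, hyK⟩).2 (fun e => hz (e ▸ hy))] at e
  exact e.symm

lemma exists_mem_hull (hx : M.nodal z x ≠ 0) : ∃ K ∈ M.elems, x ∈ hull K := by
  by_contra h
  refine hx ((M.nodal_spec z).2.2 x fun hxΩ => h ?_)
  rw [← M.cover] at hxΩ
  simpa using hxΩ

lemma nodal_nonneg (z x : E d) : 0 ≤ M.nodal z x := by
  by_contra h
  obtain ⟨K, hK, hx⟩ := exists_mem_hull (M := M) (x := x) (z := z) (fun e => h e.ge)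
  by_cases hz : z ∈ K
  · rw [nodal_eq_bary hK hx hz] at h
    exact h (((isBary hK).mem_hull_iff x).1 hx z hz)
  · rw [nodal_eq_zero hK subset_rfl hx hz] at h
    exact h le_rfl

lemma mem_adj : K ∈ M.adj S ↔ K ∈ M.elems ∧ S ⊆ K := by
  simp [adj]

lemma mem_patch : x ∈ M.patch S ↔ ∃ K ∈ M.elems, S ⊆ K ∧ x ∈ hull K := by
  simp [patch, mem_adj, and_assoc]

/-- Elements all have `d + 1` vertices, so none properly contains another. Statements about `patch
S` thereby cover elements as well as faces. -/
lemma patch_elem (hK : K ∈ M.elems) : M.patch K = hull K := by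
  ext x
  rw [mem_patch]
  refine ⟨fun ⟨L, hL, hKL, hx⟩ => ?_, fun hx => ⟨K, hK, subset_rfl, hx⟩⟩
  rwa [eq_of_subset hK hL hKL]

/-- If all nodal functions of a nonempty set of vertices are positive, the point lies in the
patch. -/
lemma mem_patch_of_pos (hS : S.Nonempty) (hx : ∀ z ∈ S, 0 < M.nodal z x) : x ∈ M.patch S := by
  obtain ⟨z, hz⟩ := hS
  obtain ⟨K, hK, hxK⟩ := exists_mem_hull (hx z hz).ne'
  refine mem_patch.2 ⟨K, hK, fun y hy => ?_, hxK⟩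
  by_contra hyK
  exact (hx y hy).ne' (nodal_eq_zero hK subset_rfl hxK hyK)

/-- If `φ_z(x) = 0`, push `x` slightly away from `z`. The new point is still in the patch, hence in
an element `L` having `z` as a vertex; by convexity `x` is in `L` too, and the coordinate of the new
point at `z` would be negative. -/
lemma pos_of_mem_interior_patch (hx : x ∈ interior (M.patch S)) (hz : z ∈ S) :
    0 < M.nodal z x := by
  refine lt_of_le_of_ne (nodal_nonneg z x) fun h0 => ?_
  have hlim : Filter.Tendsto (fun t : ℝ => x + t • (x - z)) (nhdsWithin 0 (Ioi 0)) (nhds x) := by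
    refine Filter.Tendsto.mono_left ?_ nhdsWithin_le_nhds
    exact Continuous.tendsto' (by fun_prop) _ _ (by simp)
  have hev := hlim.eventually (mem_interior_iff_mem_nhds.1 hx)
  obtain ⟨t, hty, ht : 0 < t⟩ := (hev.and self_mem_nhdsWithin).exists
  obtain ⟨L, hL, hSL, hyL⟩ := mem_patch.1 hty
  have hB := isBary hL
  have hzL := hSL hz
  have e : x + t • (x - z) = x + (-t) • (z - x) := by
    rw [neg_smul, ← smul_neg, neg_sub]
  have hxL : x ∈ hull L := by
    have hconv : Convex ℝ (hull L) := convex_convexHull ℝ _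
    have := hconv hyL (subset_convexHull ℝ _ hzL : z ∈ hull L)
      (a := 1 / (1 + t)) (b := t / (1 + t)) (by positivity) (by positivity)
      (by field_simp)
    convert this using 1
    have h1 : (1 + t) ≠ 0 := by positivity
    have : (1 / (1 + t)) • (x + t • (x - z)) + (t / (1 + t)) • z
        = ((1 + t) / (1 + t)) • x := by
      rw [add_div, add_smul, smul_add, smul_smul, smul_sub]
      rw [show 1 / (1 + t) * t = t / (1 + t) by ring]
      abel
    rw [this, div_self h1, one_smul]
  have h1 := (hB.mem_hull_iff _).1 hyL z hzL
  rw [e, affine_add_smul_sub, hB.apply_self z hzL, ← nodal_eq_bary hL hxL hzL, ← h0] at h1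
  linarith

/-- The combinatorial source of all support statements: on the interior of the patch every `φ_z`
with `z ∈ S` is positive, whereas on `G` it vanishes unless `z ∈ G`. -/
lemma subset_of_mem_interior_patch (hL : L ∈ M.elems) (hG : G ⊆ L) (hx : x ∈ hull G)
    (hxS : x ∈ interior (M.patch S)) : S ⊆ G := fun z hz => by
  by_contra hzG
  exact (pos_of_mem_interior_patch hxS hz).ne' (nodal_eq_zero hL hG hx hzG)

lemma mem_interior_elem_of_pos (hK : K ∈ M.elems) (hx : ∀ z ∈ K, 0 < M.nodal z x) :
    x ∈ interior (hull K) := by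
  have hne : K.Nonempty := Finset.card_pos.1 (by rw [M.card_eq K hK]; omega)
  have hxK : x ∈ hull K := by
    rw [← patch_elem hK]
    exact mem_patch_of_pos hne hx
  refine ((isBary hK).mem_interior_iff x).2 fun z hz => ?_
  rw [← nodal_eq_bary hK hxK hz]
  exact hx z hz

lemma ae_notMem_frontier (K : Finset (E d)) : ∀ᵐ x ∂(volume : Measure (E d)), x ∈ hull K →
    x ∈ interior (hull K) := by
  have h : volume (frontier (hull K)) = 0 := (convex_convexHull ℝ _).addHaar_frontier volume
  filter_upwards [measure_eq_zero_iff_ae_notMem.1 h] with x hx hxK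
  by_contra hxi
  exact hx ⟨subset_closure hxK, hxi⟩

lemma ae_disjoint (hK : K ∈ M.elems) (hL : L ∈ M.elems) (hne : K ≠ L) :
    ∀ᵐ x ∂(volume : Measure (E d)), x ∈ hull K → x ∉ hull L := by
  filter_upwards [ae_notMem_frontier K] with x hx hxK hxL
  rw [← patch_elem hK] at hx hxK
  exact hne (eq_of_subset hK hL (subset_of_mem_interior_patch hL subset_rfl hxL (hx hxK)))

lemma mem_faces : F ∈ M.faces ↔
    ∃ K ∈ M.elems, ∃ L ∈ M.elems, (F : Set (E d)) = (K : Set (E d)) ∩ L ∧ F.card = d := by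
  classical
  simp only [faces, Finset.mem_filter, Finset.mem_image, Finset.mem_product, Prod.exists]
  constructor
  · rintro ⟨⟨K, L, ⟨hK, hL⟩, rfl⟩, h⟩
    exact ⟨K, hK, L, hL, by ext; simp, h⟩
  · rintro ⟨K, hK, L, hL, he, h⟩
    exact ⟨⟨K, L, ⟨hK, hL⟩, by apply Finset.coe_injective; rw [he]; simp⟩, h⟩

/-- The point with equal barycentric coordinates on `G`. -/
lemma exists_center (M : Mesh Ω) (hne : G.Nonempty) :
    ∃ c : E d, c ∈ hull G ∧ ∀ L ∈ M.elems, G ⊆ L → ∀ z ∈ G, 0 < bary L z c := by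
  classical
  have hpos : (0 : ℝ) < G.card := by exact_mod_cast hne.card_pos
  have hw : ∑ y ∈ G, (1 / (G.card : ℝ)) = 1 := by
    rw [Finset.sum_const, nsmul_eq_mul]
    field_simp
  refine ⟨∑ y ∈ G, (1 / (G.card : ℝ)) • y, ?_, ?_⟩
  · exact (convex_convexHull ℝ _).sum_mem (fun _ _ => by positivity) hw
      fun y hy => subset_convexHull ℝ _ hy
  · intro L hL hGL z hz
    have hB := isBary hL
    rw [affine_sum_smul G _ _ hw]
    refine Finset.sum_pos' (fun y hy => ?_) ⟨z, hz, ?_⟩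
    · by_cases e : y = z
      · subst e
        rw [hB.apply_self y (hGL hy)]
        positivity
      · rw [hB.apply_ne z (hGL hz) y (hGL hy) e, mul_zero]
    · rw [hB.apply_self z (hGL hz)]
      positivity

/-- Two elements with a common face lie on opposite sides of it. -/
lemma bary_opposite_neg {z₁ z₂ : E d} (hd : 1 ≤ d) (hK : K ∈ M.elems) (hL : L ∈ M.elems)
    (hF : F.card = d) (hFK : F ⊆ K) (hFL : F ⊆ L) (hne : K ≠ L)
    (h1 : z₁ ∈ K) (h1F : z₁ ∉ F) (h2 : z₂ ∈ L) (h2F : z₂ ∉ F) : bary K z₁ z₂ < 0 := by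
  classical
  have hKF : K = insert z₁ F := (Finset.eq_of_subset_of_card_le (Finset.insert_subset h1 hFK)
    (by rw [M.card_eq K hK, Finset.card_insert_of_notMem h1F, hF])).symm
  have hLF : L = insert z₂ F := (Finset.eq_of_subset_of_card_le (Finset.insert_subset h2 hFL)
    (by rw [M.card_eq L hL, Finset.card_insert_of_notMem h2F, hF])).symm
  have hBK := isBary hK
  have hBL := isBary hL
  -- Both coordinates vanish on the hyperplane of `F`, hence are proportional; the factor is the
  -- value at `z₂`.
  have hh : ∀ x, bary K z₁ x = bary L z₂ x * bary K z₁ z₂ := fun x => by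
    rw [hBL.affine_eq (bary K z₁) x, Finset.sum_eq_single z₂]
    · intro y hy hyz
      have hyF : y ∈ F := by
        rw [hLF] at hy
        exact (Finset.mem_insert.1 hy).resolve_left hyz
      rw [hBK.apply_ne z₁ h1 y (hFK hyF) (fun e => h1F (e ▸ hyF)), mul_zero]
    · exact fun hn => absurd h2 hn
  by_contra hneg
  have hpos : 0 < bary K z₁ z₂ := by
    refine lt_of_le_of_ne (not_lt.1 hneg) fun h0 => ?_
    have := hh z₁
    rw [← h0, hBK.apply_self z₁ h1] at this
    simp at this
  -- Were both elements on one side, moving the centre of `F` a little towards `z₁` would give a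
  -- point of both. Face-to-face conformity puts it on `F`, but its coordinate at `z₁` is `t > 0`.
  obtain ⟨c, hcF, hc⟩ := exists_center (G := F) M (Finset.card_pos.1 (by omega))
  have hc1 : bary K z₁ c = 0 := hBK.eq_zero_of_mem_hull hFK hcF h1 h1F
  have hev : ∀ᶠ t : ℝ in nhdsWithin 0 (Ioi 0), ∀ z ∈ F, 0 < bary L z (c + t • (z₁ - c)) := by
    rw [Filter.eventually_all_finset]
    intro z hz
    have hlim : Filter.Tendsto (fun t : ℝ => bary L z (c + t • (z₁ - c)))
        (nhdsWithin 0 (Ioi 0)) (nhds (bary L z c)) := by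
      refine Filter.Tendsto.mono_left ?_ nhdsWithin_le_nhds
      simp only [affine_add_smul_sub]
      exact Continuous.tendsto' (by fun_prop) _ _ (by simp)
    exact hlim.eventually (lt_mem_nhds (hc L hL hFL z hz))
  have hlt : ∀ᶠ t : ℝ in nhdsWithin 0 (Ioi 0), t < 1 :=
    Filter.Eventually.filter_mono nhdsWithin_le_nhds (gt_mem_nhds one_pos)
  obtain ⟨t, ⟨htF, ht1⟩, ht0 : 0 < t⟩ := ((hev.and hlt).and self_mem_nhdsWithin).exists
  set y := c + t • (z₁ - c) with hy
  have hyh : bary K z₁ y = t := by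
    rw [hy, affine_add_smul_sub, hc1, hBK.apply_self z₁ h1]
    ring
  have hyK : y ∈ hull K := (convex_convexHull ℝ _).add_smul_sub_mem
    (convexHull_mono (by exact_mod_cast hFK) hcF) (subset_convexHull ℝ _ h1) ⟨ht0.le, ht1.le⟩
  have hyL : y ∈ hull L := by
    refine (hBL.mem_hull_iff y).2 fun z hz => ?_
    rw [hLF] at hz
    rcases Finset.mem_insert.1 hz with rfl | hz
    · have := hh y
      rw [hyh] at this
      exact (pos_of_mul_pos_left (this ▸ ht0) hpos.le).le
    · exact (htF z hz).le
  have hyF := M.face_to_face K hK L hL ⟨hyK, hyL⟩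
  have hz1L : z₁ ∉ L := fun h => hne (eq_of_subset hK hL (by
    rw [hKF]; exact Finset.insert_subset h hFL))
  have hsub : (K : Set (E d)) ∩ L ⊆ F := by
    rintro w ⟨hwK, hwL⟩
    rw [hKF, Finset.coe_insert] at hwK
    exact hwK.resolve_left fun e => hz1L (e ▸ hwL)
  have := hBK.eq_zero_of_mem_hull hFK (convexHull_mono hsub hyF) h1 h1F
  rw [hyh] at this
  exact ht0.ne' this

/-- The two elements at an interelement face, and the vertices opposite to it. -/
lemma exists_face_structure (hd : 1 ≤ d) (hF : F ∈ M.faces) :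
    ∃ K ∈ M.elems, ∃ L ∈ M.elems, ∃ z₁ z₂ : E d, z₁ ∉ F ∧ z₂ ∉ F ∧ z₁ ∉ L ∧ z₂ ∉ K ∧
      (∀ y, y ∈ K ↔ y = z₁ ∨ y ∈ F) ∧ (∀ y, y ∈ L ↔ y = z₂ ∨ y ∈ F) ∧
      (∀ T, T ∈ M.adj F ↔ T = K ∨ T = L) ∧ (∀ y, y ∈ M.opposite F ↔ y = z₁ ∨ y = z₂) ∧
      bary K z₁ z₂ < 0 := by
  classical
  obtain ⟨K, hK, L, hL, hFe, hFc⟩ := mem_faces.1 hF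
  have hFe' : F = K ∩ L := by apply Finset.coe_injective; rw [hFe]; simp
  have hFK : F ⊆ K := hFe' ▸ Finset.inter_subset_left
  have hFL : F ⊆ L := hFe' ▸ Finset.inter_subset_right
  have key : ∀ T ∈ M.elems, F ⊆ T → ∃ z, z ∉ F ∧ T = insert z F := by
    intro T hT hFT
    obtain ⟨z, hz, hzF⟩ : ∃ z ∈ T, z ∉ F := by
      by_contra! h
      have := Finset.card_le_card h
      rw [M.card_eq T hT, hFc] at this
      omega
    exact ⟨z, hzF, (Finset.eq_of_subset_of_card_le (Finset.insert_subset hz hFT)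
      (by rw [M.card_eq T hT, Finset.card_insert_of_notMem hzF, hFc])).symm⟩
  obtain ⟨z₁, h1F, hK1⟩ := key K hK hFK
  obtain ⟨z₂, h2F, hL2⟩ := key L hL hFL
  have hne : K ≠ L := by
    rintro rfl
    rw [Finset.inter_self] at hFe'
    rw [hFe', M.card_eq K hK] at hFc
    omega
  have h1K : z₁ ∈ K := hK1 ▸ Finset.mem_insert_self _ _
  have h2L : z₂ ∈ L := hL2 ▸ Finset.mem_insert_self _ _
  have h1L : z₁ ∉ L := fun h => h1F (hFe' ▸ Finset.mem_inter.2 ⟨h1K, h⟩)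
  have h2K : z₂ ∉ K := fun h => h2F (hFe' ▸ Finset.mem_inter.2 ⟨h, h2L⟩)
  have hneg := bary_opposite_neg hd hK hL hFc hFK hFL hne h1K h1F h2L h2F
  have hadj : ∀ T, T ∈ M.adj F ↔ T = K ∨ T = L := by
    intro T
    rw [mem_adj]
    constructor
    · rintro ⟨hT, hFT⟩
      by_contra! hTne
      obtain ⟨z₃, h3F, hT3⟩ := key T hT hFT
      have h3T : z₃ ∈ T := hT3 ▸ Finset.mem_insert_self _ _
      have n1 := bary_opposite_neg hd hK hT hFc hFK hFT hTne.1.symm h1K h1F h3T h3F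
      have n2 := bary_opposite_neg hd hL hT hFc hFL hFT hTne.2.symm h2L h2F h3T h3F
      -- A third element would lie opposite to both `K` and `L`, so a negative number would equal a
      -- product of two negative ones.
      have hh : bary K z₁ z₃ = bary L z₂ z₃ * bary K z₁ z₂ := by
        rw [(isBary hL).affine_eq (bary K z₁) z₃, Finset.sum_eq_single z₂]
        · intro y hy hyz
          have hyF : y ∈ F := by
            rw [hL2] at hy
            exact (Finset.mem_insert.1 hy).resolve_left hyz
          rw [(isBary hK).apply_ne z₁ h1K y (hFK hyF) (fun e => h1F (e ▸ hyF)), mul_zero]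
        · exact fun hn => absurd h2L hn
      nlinarith
    · rintro (rfl | rfl)
      · exact ⟨hK, hFK⟩
      · exact ⟨hL, hFL⟩
  refine ⟨K, hK, L, hL, z₁, z₂, h1F, h2F, h1L, h2K, fun y => by rw [hK1, Finset.mem_insert],
    fun y => by rw [hL2, Finset.mem_insert], hadj, fun y => ?_, hneg⟩
  simp only [opposite, Finset.mem_biUnion, hadj, Finset.mem_sdiff]
  constructor
  · rintro ⟨T, rfl | rfl, hyT, hyF⟩
    · rw [hK1, Finset.mem_insert] at hyT
      exact Or.inl (hyT.resolve_right hyF)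
    · rw [hL2, Finset.mem_insert] at hyT
      exact Or.inr (hyT.resolve_right hyF)
  · rintro (rfl | rfl)
    · exact ⟨K, Or.inl rfl, h1K, h1F⟩
    · exact ⟨L, Or.inr rfl, h2L, h2F⟩

/-- A facet of an element that is no interelement face does not meet the domain. -/
lemma hull_erase_disjoint [DecidableEq (E d)] (hd : 1 ≤ d) (hΩ : IsOpen Ω) (hK : K ∈ M.elems)
    (hz : z ∈ K) (hG : K.erase z ∉ M.faces) (hx : x ∈ hull (K.erase z)) : x ∉ Ω := by
  intro hxΩ
  set G := K.erase z with hGdef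
  have hGK : G ⊆ K := Finset.erase_subset _ _
  have hGc : G.card = d := by
    rw [hGdef, Finset.card_erase_of_mem hz, M.card_eq K hK]
    rfl
  have hzG : z ∉ G := Finset.notMem_erase z K
  have hB := isBary hK
  obtain ⟨c, hcG, hc⟩ := exists_center (G := G) M (Finset.card_pos.1 (by omega))
  have hev : ∀ᶠ t : ℝ in nhdsWithin 0 (Ioi 0), x + t • (c - x) ∈ Ω := by
    have hlim : Filter.Tendsto (fun t : ℝ => x + t • (c - x)) (nhdsWithin 0 (Ioi 0)) (nhds x) := by
      refine Filter.Tendsto.mono_left ?_ nhdsWithin_le_nhds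
      exact Continuous.tendsto' (by fun_prop) _ _ (by simp)
    exact hlim.eventually (hΩ.mem_nhds hxΩ)
  have hlt : ∀ᶠ t : ℝ in nhdsWithin 0 (Ioi 0), t < 1 :=
    Filter.Eventually.filter_mono nhdsWithin_le_nhds (gt_mem_nhds one_pos)
  obtain ⟨t, ⟨htΩ, ht1⟩, ht0 : 0 < t⟩ := ((hev.and hlt).and self_mem_nhdsWithin).exists
  -- Moving towards the centre of `G` makes all coordinates on `G` positive while staying in `Ω`.
  set y := x + t • (c - x) with hy
  have hyG : y ∈ hull G := (convex_convexHull ℝ _).add_smul_sub_mem hx hcG ⟨ht0.le, ht1.le⟩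
  have hyK : y ∈ hull K := convexHull_mono (by exact_mod_cast hGK) hyG
  have hyz : bary K z y = 0 := hB.eq_zero_of_mem_hull hGK hyG hz hzG
  have hypos : ∀ q ∈ G, 0 < bary K q y := fun q hq => by
    rw [hy, affine_add_smul_sub]
    have h1 := hc K hK hGK q hq
    have h2 := (hB.mem_hull_iff x).1 (convexHull_mono (by exact_mod_cast hGK) hx) q (hGK hq)
    have := mul_pos ht0 h1
    have := mul_nonneg (sub_nonneg.2 ht1.le) h2
    linarith
  let U : Set (E d) := ⋃ L ∈ M.elems.erase K, hull L
  have hU : IsClosed U :=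
    (M.elems.erase K).finite_toSet.isClosed_biUnion fun L _ => (isCompact_hull L).isClosed
  have hlim : Filter.Tendsto (fun t : ℝ => y + t • (y - z)) (nhdsWithin 0 (Ioi 0)) (nhds y) := by
    refine Filter.Tendsto.mono_left ?_ nhdsWithin_le_nhds
    exact Continuous.tendsto' (by fun_prop) _ _ (by simp)
  -- Leaving `K` through `G` at `y` one stays in `Ω` for a while, hence in other elements; their
  -- union is closed and so contains `y`.
  have hyU : y ∈ U := by
    refine hU.mem_of_tendsto hlim ?_
    filter_upwards [hlim.eventually (hΩ.mem_nhds htΩ), self_mem_nhdsWithin] with s hs hs0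
    have hs0' : 0 < s := hs0
    have hcl := subset_closure hs
    rw [← M.cover] at hcl
    obtain ⟨L, hL, hyL⟩ := mem_iUnion₂.1 hcl
    refine mem_iUnion₂.2 ⟨L, Finset.mem_erase.2 ⟨?_, hL⟩, hyL⟩
    rintro rfl
    have h1 := (hB.mem_hull_iff _).1 hyL z hz
    rw [show y + s • (y - z) = y + (-s) • (z - y) by rw [neg_smul, ← smul_neg, neg_sub],
      affine_add_smul_sub, hyz, hB.apply_self z hz] at h1
    linarith
  obtain ⟨L, hL, hyL⟩ := mem_iUnion₂.1 hyU
  obtain ⟨hne, hL⟩ := Finset.mem_erase.1 hL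
  have hGL : G ⊆ L := fun q hq => by
    by_contra hqL
    have h1 := hypos q hq
    rw [← nodal_eq_bary hK hyK (hGK hq), nodal_eq_zero hL subset_rfl hyL hqL] at h1
    exact h1.false
  refine hG (mem_faces.2 ⟨K, hK, L, hL, ?_, hGc⟩)
  have hKL : G = K ∩ L := by
    refine Finset.eq_of_subset_of_card_le (Finset.subset_inter hGK hGL) ?_
    have h1 : (K ∩ L).card < K.card := by
      refine Finset.card_lt_card (Finset.ssubset_iff_subset_ne.2 ⟨Finset.inter_subset_left, ?_⟩)
      exact fun e => hne (eq_of_subset hK hL (Finset.inter_eq_left.1 e)).symm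
    rw [M.card_eq K hK] at h1
    omega
  rw [hKL, Finset.coe_inter]

end Mesh

/-! ### Locally Lipschitz functions -/

section locLip
variable {d : ℕ}

lemma _root_.LocallyLipschitz.mul_real {f g : E d → ℝ} (hf : LocallyLipschitz f)
    (hg : LocallyLipschitz g) : LocallyLipschitz fun x => f x * g x :=
  (ContDiff.locallyLipschitz (𝕂 := ℝ) (f := fun p : ℝ × ℝ => p.1 * p.2) (by fun_prop)).comp
    (hf.prodMk hg)

lemma locallyLipschitz_finset_prod {ι : Type*} (s : Finset ι) {f : ι → E d → ℝ}
    (hf : ∀ i, LocallyLipschitz (f i)) : LocallyLipschitz fun x => ∏ i ∈ s, f i x := by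
  classical
  induction s using Finset.induction_on with
  | empty => simpa using LocallyLipschitz.const (1 : ℝ)
  | insert i s hi ih =>
    simp only [Finset.prod_insert hi]
    exact (hf i).mul_real ih

lemma locallyLipschitz_affine (a : E d →ᵃ[ℝ] ℝ) : LocallyLipschitz a :=
  a.lipschitzWith_of_finiteDimensional.choose_spec.locallyLipschitz

/-- On a compact ball around `ω` with margin `1` local Lipschitz continuity is uniform. A point
outside that ball is at distance at least `1` from `ω`, and there the sup bound `B` serves as
Lipschitz constant. -/
lemma exists_lipschitzWith {f : E d → ℝ} {ω : Set (E d)} (hf : LocallyLipschitz f)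
    (hb : Bornology.IsBounded ω) (h0 : ∀ x, x ∉ ω → f x = 0) : ∃ L, LipschitzWith L f := by
  obtain ⟨R, hR⟩ := hb.subset_closedBall 0
  obtain ⟨L, hL⟩ := hf.locallyLipschitzOn.exists_lipschitzOnWith_of_compact
    (isCompact_closedBall (0 : E d) (R + 1))
  obtain ⟨B, hB⟩ := (isCompact_closedBall (0 : E d) (R + 1)).exists_bound_of_continuousOn
    hf.continuous.continuousOn
  have key : ∀ x y, x ∈ ω → dist (f x) (f y) ≤ (L + B.toNNReal : NNReal) * dist x y := by
    intro x y hx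
    have hxR := Metric.mem_closedBall.1 (hR hx)
    have hxB : x ∈ Metric.closedBall (0 : E d) (R + 1) := Metric.mem_closedBall.2 (by linarith)
    have hd := dist_nonneg (x := x) (y := y)
    push_cast
    by_cases hy : y ∈ Metric.closedBall (0 : E d) (R + 1)
    · refine (hL.dist_le_mul x hxB y hy).trans ?_
      gcongr
      simp
    · have hyω : y ∉ ω := fun h => hy (Metric.closedBall_subset_closedBall (by linarith) (hR h))
      have h1 : 1 ≤ dist x y := by
        rw [Metric.mem_closedBall, not_le] at hy
        have := dist_triangle y x 0
        rw [dist_comm y x] at this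
        linarith
      rw [h0 y hyω, dist_zero_right]
      have h2 := hB x hxB
      have h3 : B ≤ B.toNNReal := Real.le_coe_toNNReal B
      have h4 : (0 : ℝ) ≤ L := L.2
      have h5 : (0 : ℝ) ≤ B.toNNReal := B.toNNReal.2
      nlinarith
  refine ⟨L + B.toNNReal, LipschitzWith.of_dist_le_mul fun x y => ?_⟩
  by_cases hx : x ∈ ω
  · exact key x y hx
  · by_cases hy : y ∈ ω
    · rw [dist_comm, dist_comm x y]
      exact key y x hy
    · rw [h0 x hx, h0 y hy, dist_self]
      positivity

end locLip

namespace Mesh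
variable {d : ℕ} {Ω : Set (E d)} {M : Mesh Ω} {K L F G S : Finset (E d)} {x z : E d}

/-! ### The test functions belong to `H¹₀` -/

lemma psiElem_eq_zero (hK : K ∈ M.elems) (hx : x ∉ interior (hull K)) : M.psiElem K x = 0 := by
  by_contra h
  refine hx (mem_interior_elem_of_pos hK fun z hz => lt_of_le_of_ne (nodal_nonneg z x) fun e => ?_)
  exact h (by rw [psiElem, Finset.prod_eq_zero hz e.symm, mul_zero])

/-- Replacing nodal functions by positive parts of global affine coordinates changes nothing: off
`K` some coordinate is negative and kills the product. -/
lemma locallyLipschitz_psiElem (hK : K ∈ M.elems) : LocallyLipschitz (M.psiElem K) := by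
  have h : M.psiElem K = fun x => ((2 * d + 1).factorial : ℝ) / (d.factorial * vol K) *
      ∏ z ∈ K, max (bary K z x) 0 := by
    funext x
    by_cases hx : x ∈ hull K
    · rw [psiElem]
      congr 1
      refine Finset.prod_congr rfl fun z hz => ?_
      rw [nodal_eq_bary hK hx hz, max_eq_left (((isBary hK).mem_hull_iff x).1 hx z hz)]
    · rw [psiElem_eq_zero hK fun h => hx (interior_subset h)]
      rw [(isBary hK).mem_hull_iff] at hx
      push Not at hx
      obtain ⟨z, hz, hneg⟩ := hx
      rw [Finset.prod_eq_zero hz (max_eq_right hneg.le), mul_zero]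
  rw [h]
  exact (LocallyLipschitz.const _).mul_real
    (locallyLipschitz_finset_prod K fun z => (locallyLipschitz_affine (bary K z)).max_const 0)

/-- Global piecewise affine functions that represent the nodal functions on the patch of a face. -/
lemma exists_face_functions (hd : 1 ≤ d) (hF : F ∈ M.faces) :
    ∃ (g : E d → E d → ℝ) (m : E d → ℝ), (∀ z, LocallyLipschitz (g z)) ∧ LocallyLipschitz m ∧
      (∀ x ∈ M.patch F, ∀ z ∈ F, M.nodal z x = g z x) ∧
      (∀ x ∈ M.patch F, ∑ z ∈ M.opposite F, M.nodal z x = m x) ∧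
      ∀ x, (∀ z ∈ F, 0 < g z x) → x ∈ M.patch F := by
  classical
  obtain ⟨K, hK, L, hL, z₁, z₂, h1F, h2F, h1L, h2K, hKF, hLF, hadj, hopp, hneg⟩ :=
    exists_face_structure hd hF
  have hBK := isBary hK
  have hBL := isBary hL
  have h1K : z₁ ∈ K := (hKF _).2 (Or.inl rfl)
  have h2L : z₂ ∈ L := (hLF _).2 (Or.inl rfl)
  have hFK : F ⊆ K := fun y hy => (hKF y).2 (Or.inr hy)
  have hFL : F ⊆ L := fun y hy => (hLF y).2 (Or.inr hy)
  have hKe : K = insert z₁ F := by ext y; rw [hKF, Finset.mem_insert]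
  have hLe : L = insert z₂ F := by ext y; rw [hLF, Finset.mem_insert]
  have hpatch : ∀ x, x ∈ M.patch F ↔ x ∈ hull K ∨ x ∈ hull L := by
    intro x
    simp only [patch, hadj, mem_iUnion, exists_prop]
    constructor
    · rintro ⟨T, rfl | rfl, hT⟩
      · exact Or.inl hT
      · exact Or.inr hT
    · rintro (h | h)
      · exact ⟨K, Or.inl rfl, h⟩
      · exact ⟨L, Or.inr rfl, h⟩
  have hh : ∀ x, bary K z₁ x = bary L z₂ x * bary K z₁ z₂ := fun x => by
    rw [hBL.affine_eq (bary K z₁) x, hLe, Finset.sum_insert h2F, ← hLe,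
      Finset.sum_eq_zero, add_zero]
    intro y hy
    rw [hBK.apply_ne z₁ h1K y (hFK hy) (fun e => h1F (e ▸ hy)), mul_zero]
  have hg : ∀ z ∈ F, ∀ x, bary L z x = bary K z x - bary K z z₂ * bary L z₂ x := fun z hz x => by
    rw [hBL.affine_eq (bary K z) x, hLe, Finset.sum_insert h2F, ← hLe,
      Finset.sum_eq_single z]
    · rw [hBK.apply_self z (hFK hz)]
      ring
    · intro y hy hne
      rw [hBK.apply_ne z (hFK hz) y (hFK hy) hne, mul_zero]
    · exact fun hn => absurd hz hn
  have hoppsum : ∀ x, ∑ z ∈ M.opposite F, M.nodal z x = M.nodal z₁ x + M.nodal z₂ x := fun x => by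
    have e : M.opposite F = {z₁, z₂} := by ext y; rw [hopp]; simp
    rw [e, Finset.sum_pair fun e : z₁ = z₂ => h1L (e ▸ h2L)]
  have hKneg : ∀ x ∈ hull K, bary L z₂ x ≤ 0 := fun x hx => by
    have h1 := (hBK.mem_hull_iff x).1 hx z₁ h1K
    rw [hh] at h1
    by_contra! h
    nlinarith
  -- The positive part of `bary L z₂` vanishes on `K`; on `L` it is the correction `hg` that turns
  -- `bary K z` into `bary L z`.
  refine ⟨fun z x => bary K z x - bary K z z₂ * max (bary L z₂ x) 0,
    fun x => max (bary K z₁ x) 0 + max (bary L z₂ x) 0, fun z => ?_, ?_, ?_, ?_, ?_⟩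
  · exact (locallyLipschitz_affine _).sub ((LocallyLipschitz.const _).mul_real
      ((locallyLipschitz_affine _).max_const 0))
  · exact ((locallyLipschitz_affine _).max_const 0).add ((locallyLipschitz_affine _).max_const 0)
  · intro x hx z hz
    rcases (hpatch x).1 hx with hx | hx
    · simp only [max_eq_right (hKneg x hx), mul_zero, sub_zero]
      exact nodal_eq_bary hK hx (hFK hz)
    · simp only [max_eq_left ((hBL.mem_hull_iff x).1 hx z₂ h2L)]
      rw [← hg z hz x]
      exact nodal_eq_bary hL hx (hFL hz)
  · intro x hx
    rw [hoppsum]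
    rcases (hpatch x).1 hx with hx | hx
    · simp only [max_eq_right (hKneg x hx), max_eq_left ((hBK.mem_hull_iff x).1 hx z₁ h1K)]
      rw [nodal_eq_bary hK hx h1K, nodal_eq_zero hK subset_rfl hx h2K]
    · have h2 := (hBL.mem_hull_iff x).1 hx z₂ h2L
      have h1 : bary K z₁ x ≤ 0 := by
        rw [hh]
        exact mul_nonpos_of_nonneg_of_nonpos h2 hneg.le
      simp only [max_eq_left h2, max_eq_right h1]
      rw [nodal_eq_bary hL hx h2L, nodal_eq_zero hL subset_rfl hx h1L]
  · intro x hx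
    rw [hpatch]
    rcases le_or_gt (bary L z₂ x) 0 with h | h
    · left
      refine (hBK.mem_hull_iff x).2 fun z hz => ?_
      rcases (hKF z).1 hz with rfl | hz
      · rw [hh]
        exact mul_nonneg_of_nonpos_of_nonpos h hneg.le
      · have := hx z hz
        simp only [max_eq_right h, mul_zero, sub_zero] at this
        exact this.le
    · right
      refine (hBL.mem_hull_iff x).2 fun z hz => ?_
      rcases (hLF z).1 hz with rfl | hz
      · exact h.le
      · have := hx z hz
        simp only [max_eq_left h.le] at this
        rw [hg z hz]
        exact this.le

lemma nonempty_of_mem_faces (hd : 1 ≤ d) (hF : F ∈ M.faces) : F.Nonempty := by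
  obtain ⟨-, -, -, -, -, h⟩ := mem_faces.1 hF
  exact Finset.card_pos.1 (by omega)

/-- The global continuous functions `g` are jointly positive on an open set, and this set lies in
the patch. -/
lemma mem_interior_patch_of_pos (hd : 1 ≤ d) (hF : F ∈ M.faces)
    (hx : ∀ z ∈ F, 0 < M.nodal z x) : x ∈ interior (M.patch F) := by
  obtain ⟨g, m, hg, -, hgn, -, hgp⟩ := exists_face_functions hd hF
  have hU : IsOpen {x | ∀ z ∈ F, 0 < g z x} := by
    have : {x | ∀ z ∈ F, 0 < g z x} = ⋂ z ∈ F, {x | 0 < g z x} := by ext; simp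
    rw [this]
    exact isOpen_biInter_finset fun z _ => isOpen_lt continuous_const (hg z).continuous
  have hxp := mem_patch_of_pos (nonempty_of_mem_faces hd hF) hx
  exact interior_maximal hgp hU fun z hz => hgn x hxp z hz ▸ hx z hz

lemma psiFace_eq_zero (hd : 1 ≤ d) (hF : F ∈ M.faces) (hx : x ∉ interior (M.patch F)) :
    M.psiFace F x = 0 := by
  by_contra h
  refine hx (mem_interior_patch_of_pos hd hF fun z hz =>
    lt_of_le_of_ne (nodal_nonneg z x) fun e => ?_)
  exact h (by rw [psiFace, Finset.prod_eq_zero hz e.symm, mul_zero, zero_mul])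

lemma locallyLipschitz_psiFace (hd : 1 ≤ d) (hF : F ∈ M.faces) :
    LocallyLipschitz (M.psiFace F) := by
  obtain ⟨g, m, hg, hm, hgn, hmn, hgp⟩ := exists_face_functions hd hF
  have h : M.psiFace F = fun x => (((2 * d - 1).factorial : ℝ) / ((d - 1).factorial * area F) *
      ∏ z ∈ F, max (g z x) 0) * (1 - (2 * d + 1) * m x) := by
    funext x
    by_cases hx : x ∈ M.patch F
    · rw [psiFace, hmn x hx]
      congr 2
      refine Finset.prod_congr rfl fun z hz => ?_
      rw [← hgn x hx z hz, max_eq_left (nodal_nonneg z x)]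
    · rw [psiFace_eq_zero hd hF fun h => hx (interior_subset h)]
      obtain ⟨z, hz, hneg⟩ : ∃ z ∈ F, g z x ≤ 0 := by
        by_contra! h
        exact hx (hgp x h)
      rw [Finset.prod_eq_zero hz (max_eq_right hneg), mul_zero, zero_mul]
  rw [h]
  exact ((LocallyLipschitz.const _).mul_real
    (locallyLipschitz_finset_prod F fun z => (hg z).max_const 0)).mul_real
    ((LocallyLipschitz.const _).sub ((LocallyLipschitz.const _).mul_real hm))

lemma isBounded_patch (S : Finset (E d)) : Bornology.IsBounded (M.patch S) :=
  (Bornology.isBounded_biUnion_finset _).2 fun K _ => (isCompact_hull K).isBounded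

/-- The element of `H¹₀(Ω)` given by `ψ_K`. -/
lemma toH10_psiElem (hK : K ∈ M.elems) (hKΩ : interior (hull K) ⊆ Ω) :
    (toH10 Ω (M.psiElem K) : Pairs d) ∈ H10 (interior (hull K)) ∧
      (fn (toH10 Ω (M.psiElem K)) : E d → ℝ) =ᵐ[volume] M.psiElem K := by
  have hb : Bornology.IsBounded (interior (hull K)) :=
    (isCompact_hull K).isBounded.subset interior_subset
  obtain ⟨L, hL⟩ := exists_lipschitzWith (locallyLipschitz_psiElem hK) hb
    fun x => psiElem_eq_zero hK
  obtain ⟨v, h1, h2, -⟩ := exists_H10_trace_eq isOpen_interior hKΩ hb hL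
    fun x => psiElem_eq_zero hK
  rw [toH10_eq h2]
  exact ⟨h1, h2⟩

/-- The element of `H¹₀(Ω)` given by `ψ_F`, and its traces. -/
lemma toH10_psiFace (hd : 1 ≤ d) (hF : F ∈ M.faces) (hFΩ : interior (M.patch F) ⊆ Ω) :
    (toH10 Ω (M.psiFace F) : Pairs d) ∈ H10 (interior (M.patch F)) ∧
      (fn (toH10 Ω (M.psiFace F)) : E d → ℝ) =ᵐ[volume] M.psiFace F ∧
      ∀ G : Finset (E d), IsFiniteMeasure (surf G) → ∀ T : H10 Ω →L[ℝ] Lp ℝ 1 (surf G),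
        IsTraceOp G T → (T (toH10 Ω (M.psiFace F)) : E d → ℝ) =ᵐ[surf G] M.psiFace F := by
  have hb : Bornology.IsBounded (interior (M.patch F)) :=
    (isBounded_patch F).subset interior_subset
  obtain ⟨L, hL⟩ := exists_lipschitzWith (locallyLipschitz_psiFace hd hF) hb
    fun x => psiFace_eq_zero hd hF
  obtain ⟨v, h1, h2, h3⟩ := exists_H10_trace_eq isOpen_interior hFΩ hb hL
    fun x => psiFace_eq_zero hd hF
  rw [toH10_eq h2]
  exact ⟨h1, h2, h3⟩

/-! ### Integrals of the test functions -/

/-- Reduces integrals of nodal products to Dirichlet integrals. The vertex `p` is singled out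
because its nodal function becomes `1 - ∑ y`. -/
lemma exists_simplex_integral {m : ℕ} (hK : K ∈ M.elems) (hS : S ⊆ K) (hm : S.card = m + 1)
    {p : E d} (hp : p ∈ S) [DecidableEq (E d)] :
    ∃ (P : (Fin m → ℝ) → E d) (c : ℝ), 0 < c ∧
      (∀ f : E d → ℝ, ∫ x in hull S, f x ∂(Measure.euclideanHausdorffMeasure m) =
        c * ∫ y in corner m, f (P y)) ∧
      ∀ y ∈ corner m, P y ∈ hull S ∧ M.nodal p (P y) = 1 - ∑ i, y i ∧
        ∏ z ∈ S.erase p, M.nodal z (P y) = ∏ i, y i := by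
  have hc : (S.erase p).card = m := by rw [Finset.card_erase_of_mem hp, hm]; rfl
  obtain ⟨w, hwi, hw⟩ := exists_enum (S.erase p) hc
  replace hw : Finset.univ.image w = S.erase p := by convert hw
  have hwS : ∀ i, w i ∈ S.erase p := fun i => hw ▸ Finset.mem_image_of_mem w (Finset.mem_univ i)
  have hwp : ∀ i, w i ≠ p := fun i => Finset.ne_of_mem_erase (hwS i)
  have hwK : ∀ i, w i ∈ K := fun i => hS (Finset.mem_of_mem_erase (hwS i))
  have hlin := linearIndependent_sub (M.indep K hK) (hS hp) hwi hwK hwp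
  have hset : (insert p (range w) : Set (E d)) = S := by
    rw [← Finset.insert_erase hp, Finset.coe_insert, ← hw]
    simp
  obtain ⟨c, hc0, hci⟩ := exists_integral_simplex_eq hlin
  rw [hset] at hci
  have hB := isBary hK
  refine ⟨par p w, c, hc0, hci, fun y hy => ?_⟩
  have hmem : par p w y ∈ hull S := by
    have := mem_image_of_mem (par p w) hy
    rwa [image_par, hset] at this
  have hmemK : par p w y ∈ hull K := convexHull_mono (by exact_mod_cast hS) hmem
  refine ⟨hmem, ?_, ?_⟩
  · rw [nodal_eq_bary hK hmemK (hS hp), affine_par, hB.apply_self p (hS hp),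
      Finset.sum_eq_zero (f := fun i => y i * bary K p (w i)) fun i _ => by
        simp only [hB.apply_ne p (hS hp) _ (hwK i) (hwp i), mul_zero]]
    ring
  · rw [← hw, Finset.prod_image fun i _ j _ hij => hwi hij]
    refine Finset.prod_congr rfl fun i _ => ?_
    rw [nodal_eq_bary hK hmemK (hwK i), affine_par, hB.apply_ne _ (hwK i) p (hS hp) (hwp i).symm,
      Finset.sum_eq_single (f := fun j => y j * bary K (w i) (w j)) i, hB.apply_self _ (hwK i)]
    · ring
    · intro j _ hj
      simp only [hB.apply_ne _ (hwK i) _ (hwK j) fun e => hj (hwi e), mul_zero]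
    · simp

/-- The integral of the product of all nodal functions of a simplex. -/
lemma integral_prod_nodal {m : ℕ} (hK : K ∈ M.elems) (hS : S ⊆ K) (hm : S.card = m + 1) :
    0 < (Measure.euclideanHausdorffMeasure m : Measure (E d)).real (hull S) ∧
    ∫ x in hull S, ∏ z ∈ S, M.nodal z x ∂(Measure.euclideanHausdorffMeasure m) =
      (m.factorial : ℝ) / (2 * m + 1).factorial *
        (Measure.euclideanHausdorffMeasure m : Measure (E d)).real (hull S) := by
  classical
  obtain ⟨p, hp⟩ : S.Nonempty := Finset.card_pos.1 (by omega)
  obtain ⟨P, c, hc, hint, hP⟩ := exists_simplex_integral hK hS hm hp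
  have h1 := hint fun _ => 1
  -- Integrating the constant `1` expresses the measure of the simplex as `c / m!`, which eliminates
  -- `c`.
  have h2 := integral_corner_pow m 0
  simp only [pow_zero, Nat.factorial_zero, Nat.cast_one, add_zero] at h2
  rw [h2] at h1
  simp only [integral_const, smul_eq_mul, mul_one, measureReal_restrict_apply_univ] at h1
  rw [h1]
  refine ⟨by positivity, ?_⟩
  rw [hint]
  have h3 : ∫ y in corner m, ∏ z ∈ S, M.nodal z (P y) =
      ∫ y in corner m, (∏ i, y i) * (1 - ∑ i, y i) ^ 1 := by
    refine setIntegral_congr_fun (isClosed_corner m).measurableSet fun y hy => ?_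
    obtain ⟨-, e1, e2⟩ := hP y hy
    rw [← Finset.mul_prod_erase S _ hp, e1, e2, pow_one, mul_comm]
  rw [h3, integral_corner_prod_mul_pow]
  simp only [Nat.factorial_one, Nat.cast_one]
  field_simp

lemma vol_eq (K : Finset (E d)) :
    vol K = (Measure.euclideanHausdorffMeasure d : Measure (E d)).real (hull K) := by
  rw [EuclideanSpace.euclideanHausdorffMeasure_eq_volume]
  rfl

lemma integral_psiElem (hK : K ∈ M.elems) : ∫ x in hull K, M.psiElem K x = 1 := by
  obtain ⟨h1, h2⟩ := integral_prod_nodal hK subset_rfl (M.card_eq K hK)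
  rw [← vol_eq] at h1 h2
  rw [EuclideanSpace.euclideanHausdorffMeasure_eq_volume] at h2
  simp only [psiElem]
  rw [integral_const_mul, h2]
  field_simp

/-- This is what the factor `1 - (2d+1)(φ_{z₁} + φ_{z₂})` is for. On an element at `F` only one of
the two opposite nodal functions survives, and the integral is proportional to `1/(2d)! -
(2d+1)/(2d+1)! = 0`. -/
lemma integral_psiFace_elem (hd : 1 ≤ d) (hF : F ∈ M.faces) (hK : K ∈ M.elems) :
    ∫ x in hull K, M.psiFace F x = 0 := by
  classical
  by_cases hFK : F ⊆ K
  swap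
  · refine setIntegral_eq_zero_of_forall_eq_zero fun x hx => ?_
    obtain ⟨z, hz, hzK⟩ := Finset.not_subset.1 hFK
    have h0 : M.nodal z x = 0 := nodal_eq_zero hK subset_rfl hx hzK
    rw [psiFace, Finset.prod_eq_zero hz h0, mul_zero, zero_mul]
  obtain ⟨K₁, hK₁, K₂, hK₂, z₁, z₂, h1F, h2F, h1K2, h2K1, hK1F, hK2F, hadj, hopp, -⟩ :=
    exists_face_structure hd hF
  obtain ⟨p, q, hpF, hqK, hKF, hsum⟩ : ∃ p q, p ∉ F ∧ q ∉ K ∧ (∀ y, y ∈ K ↔ y = p ∨ y ∈ F) ∧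
      ∀ x, ∑ z ∈ M.opposite F, M.nodal z x = M.nodal p x + M.nodal q x := by
    have hne : z₁ ≠ z₂ := fun e => h1K2 (e ▸ (hK2F _).2 (Or.inl rfl))
    have e : M.opposite F = {z₁, z₂} := by ext y; rw [hopp]; simp
    rcases (hadj K).1 (mem_adj.2 ⟨hK, hFK⟩) with rfl | rfl
    · exact ⟨z₁, z₂, h1F, h2K1, hK1F, fun x => by rw [e, Finset.sum_pair hne]⟩
    · exact ⟨z₂, z₁, h2F, h1K2, hK2F, fun x => by rw [e, Finset.sum_pair hne, add_comm]⟩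
  have hpK : p ∈ K := (hKF p).2 (Or.inl rfl)
  have hFe : K.erase p = F := by
    ext y
    rw [Finset.mem_erase, hKF]
    exact ⟨fun ⟨h1, h2⟩ => h2.resolve_left h1, fun h => ⟨fun e => hpF (e ▸ h), Or.inr h⟩⟩
  obtain ⟨P, c, hc, hint, hP⟩ := exists_simplex_integral hK subset_rfl (M.card_eq K hK) hpK
  rw [EuclideanSpace.euclideanHausdorffMeasure_eq_volume, hFe] at *
  simp only [psiFace, mul_assoc]
  rw [integral_const_mul]
  suffices h : ∫ x in hull K, (∏ z ∈ F, M.nodal z x) *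
      (1 - (2 * (d : ℝ) + 1) * ∑ z ∈ M.opposite F, M.nodal z x) = 0 by
    rw [h, mul_zero]
  rw [hint]
  have h3 : ∫ y in corner d, (∏ z ∈ F, M.nodal z (P y)) *
      (1 - (2 * (d : ℝ) + 1) * ∑ z ∈ M.opposite F, M.nodal z (P y)) =
      ∫ y in corner d, ((∏ i, y i) * (1 - ∑ i, y i) ^ 0 -
        (2 * (d : ℝ) + 1) * ((∏ i, y i) * (1 - ∑ i, y i) ^ 1)) := by
    refine setIntegral_congr_fun (isClosed_corner d).measurableSet fun y hy => ?_
    obtain ⟨e0, e1, e2⟩ := hP y hy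
    rw [e2, hsum, e1, nodal_eq_zero hK subset_rfl e0 hqK]
    ring
  have hi : ∀ k : ℕ, IntegrableOn (fun y : Fin d → ℝ => (∏ i, y i) * (1 - ∑ i, y i) ^ k)
      (corner d) := fun k =>
    (Continuous.continuousOn (by fun_prop)).integrableOn_compact (isCompact_corner d)
  rw [h3, integral_sub (hi 0) ((hi 1).const_mul _), integral_const_mul,
    integral_corner_prod_mul_pow, integral_corner_prod_mul_pow, Nat.factorial_succ (2 * d)]
  simp only [Nat.factorial_zero, Nat.factorial_one, add_zero]
  push_cast
  field_simp
  simp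

lemma face_subset_elem (hF : F ∈ M.faces) : F.card = d ∧ ∃ K ∈ M.elems, F ⊆ K := by
  obtain ⟨K, hK, L, -, h, hc⟩ := mem_faces.1 hF
  exact ⟨hc, K, hK, by rw [← Finset.coe_subset, h]; exact inter_subset_left⟩

lemma integral_psiFace_face (hd : 1 ≤ d) (hF : F ∈ M.faces) :
    ∫ x, M.psiFace F x ∂(surf F) = 1 := by
  obtain ⟨n, rfl⟩ : ∃ n, d = n + 1 := ⟨d - 1, by omega⟩
  obtain ⟨hc, K, hK, hFK⟩ := face_subset_elem hF
  obtain ⟨h1, h2⟩ := integral_prod_nodal hK hFK hc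
  have ha : (Measure.euclideanHausdorffMeasure n : Measure (E (n + 1))).real (hull F) = area F := by
    simp [area, surf]
  rw [ha] at h1 h2
  have h3 : ∫ x, M.psiFace F x ∂(surf F) = ∫ x in hull F,
      ((2 * (n + 1) - 1).factorial : ℝ) / (n.factorial * area F) * ∏ z ∈ F, M.nodal z x
        ∂(Measure.euclideanHausdorffMeasure n) := by
    refine setIntegral_congr_fun (isCompact_hull F).measurableSet fun x hx => ?_
    -- On `F` itself the correction factor is `1`.
    have h0 : ∑ z ∈ M.opposite F, M.nodal z x = 0 := Finset.sum_eq_zero fun z hz => by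
      refine nodal_eq_zero hK hFK hx fun hzF => ?_
      simp only [opposite, Finset.mem_biUnion, Finset.mem_sdiff] at hz
      obtain ⟨T, -, -, h⟩ := hz
      exact h hzF
    simp only [psiFace, h0]
    simp
  rw [h3, integral_const_mul, h2, show 2 * (n + 1) - 1 = 2 * n + 1 by omega]
  field_simp

/-! ### Traces on the faces -/

lemma isFiniteMeasure_surf_of_subset (hd : 1 ≤ d) (hK : K ∈ M.elems) (hG : G ⊆ K)
    (hc : G.card = d) : IsFiniteMeasure (surf G) := by
  obtain ⟨n, rfl⟩ : ∃ n, d = n + 1 := ⟨d - 1, by omega⟩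
  obtain ⟨h1, -⟩ := integral_prod_nodal hK hG hc
  refine ⟨?_⟩
  have : (surf G) univ = Measure.euclideanHausdorffMeasure n (hull G) := by simp [surf]
  rw [this]
  -- An infinite measure would have real value `0`.
  exact (ENNReal.toReal_pos_iff.1 h1).2

lemma isTraceOp_trace (hd : 1 ≤ d) (hΩb : Bornology.IsBounded Ω) (hF : F ∈ M.faces) :
    IsTraceOp F (trace Ω F) := by
  classical
  obtain ⟨n, rfl⟩ : ∃ n, d = n + 1 := ⟨d - 1, by omega⟩
  obtain ⟨hc, K, hK, hFK⟩ := face_subset_elem hF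
  obtain ⟨p, hp⟩ := nonempty_of_mem_faces hd hF
  -- The remaining vertex of an adjacent element provides the edge direction transversal to `F`.
  obtain ⟨q, hqK, hqF⟩ : ∃ q ∈ K, q ∉ F := by
    by_contra! h
    have := Finset.card_le_card h
    rw [M.card_eq K hK, hc] at this
    omega
  obtain ⟨w, hwi, hw⟩ := exists_enum (F.erase p) (m := n)
    (by rw [Finset.card_erase_of_mem hp, hc]; rfl)
  replace hw : Finset.univ.image w = F.erase p := by convert hw
  have hwS : ∀ i, w i ∈ F.erase p := fun i => hw ▸ Finset.mem_image_of_mem w (Finset.mem_univ i)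
  have hwF : ∀ i, w i ∈ F := fun i => Finset.mem_of_mem_erase (hwS i)
  have hlin := linearIndependent_sub (M.indep K hK) (hFK hp)
    (u := (Fin.cons q w : Fin (n + 1) → E (n + 1)))
    (Fin.cons_injective_iff.2 ⟨by rintro ⟨i, rfl⟩; exact hqF (hwF i), hwi⟩)
    (Fin.cases hqK fun i => hFK (hwF i))
    (Fin.cases (fun e : q = p => hqF (e ▸ hp)) fun i => Finset.ne_of_mem_erase (hwS i))
  obtain ⟨C, hC, hb⟩ := exists_lintegral_face_le hlin
  have hset : (insert p (range w) : Set (E (n + 1))) = F := by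
    rw [← Finset.insert_erase hp, Finset.coe_insert, ← hw]
    simp
  rw [hset] at hb
  have := isFiniteMeasure_surf_of_subset hd hK hFK hc
  have hex := exists_isTraceOp_of_bound hΩb F hC hb
  rw [trace, dif_pos hex]
  exact hex.choose_spec

end Mesh

/-! ### The functionals of elements and faces away from their supports. -/

lemma chiElem_eq_zero {d : ℕ} {Ω ω : Set (E d)} (hω : ω ⊆ Ω) {K : Finset (E d)}
    (hK : ∀ x ∈ hull K, x ∉ ω) {v : H10 Ω} (hv : (v : Pairs d) ∈ H10 ω) : chiElem Ω K v = 0 := by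
  refine eq_of_eq_on_tests hω (chiElem Ω K) 0 (fun φ hφ u hu => ?_) v hv
  rw [chiElem_apply, zero_apply]
  have h1 : ∫ x in hull K, fn u x = ∫ x in hull K, φ x :=
    integral_congr_ae (ae_restrict_of_ae hu.1)
  rw [h1]
  exact setIntegral_eq_zero_of_forall_eq_zero fun x hx => hφ.eq_zero (hK x hx)

lemma chiFace_apply_test {d : ℕ} {Ω : Set (E d)} {F : Finset (E d)} (hF : IsTraceOp F (trace Ω F))
    {φ : E d → ℝ} (hφ : IsTest Ω φ) {v : H10 Ω} (hv : IsPairOf (v : Pairs d) φ) :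
    chiFace Ω F v = ∫ x, φ x ∂(surf F) := by
  rw [chiFace_apply]
  exact integral_congr_ae (hF φ hφ v hv)

lemma chiFace_eq_zero {d : ℕ} {Ω ω : Set (E d)} (hω : ω ⊆ Ω) {F : Finset (E d)}
    (hF : IsTraceOp F (trace Ω F)) (hd : ∀ x ∈ hull F, x ∉ ω) {v : H10 Ω}
    (hv : (v : Pairs d) ∈ H10 ω) : chiFace Ω F v = 0 := by
  refine eq_of_eq_on_tests hω (chiFace Ω F) 0 (fun φ hφ u hu => ?_) v hv
  rw [chiFace_apply_test hF (hφ.mono hω) hu, zero_apply]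
  exact setIntegral_eq_zero_of_forall_eq_zero fun x hx => hφ.eq_zero (hd x hx)

namespace Mesh
variable {d : ℕ} {Ω : Set (E d)} {M : Mesh Ω} {K L F G S : Finset (E d)}

/-! ### The space of discretized residuals -/

variable (M) in
/-- The linear parametrization of the discretized residuals by their coefficients. -/
def residual : ((Finset (E d) → ℝ) × (Finset (E d) → ℝ)) →ₗ[ℝ] Hm1 Ω where
  toFun c := ∑ K ∈ M.elems, c.1 K • chiElem Ω K + ∑ F ∈ M.faces, c.2 F • chiFace Ω F
  map_add' c c' := by
    simp only [Prod.fst_add, Prod.snd_add, Pi.add_apply, add_smul, Finset.sum_add_distrib]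
    abel
  map_smul' t c := by
    simp only [Prod.smul_fst, Prod.smul_snd, Pi.smul_apply, smul_eq_mul, mul_smul, smul_add,
      Finset.smul_sum, RingHom.id_apply]

lemma residual_apply (c : (Finset (E d) → ℝ) × (Finset (E d) → ℝ)) (v : H10 Ω) :
    M.residual c v = ∑ K ∈ M.elems, c.1 K * chiElem Ω K v +
      ∑ F ∈ M.faces, c.2 F * chiFace Ω F v := by
  simp [residual, sum_apply]

lemma proj_eq_residual (ℓ : Hm1 Ω) : M.proj ℓ =
    M.residual (fun K => ℓ (toH10 Ω (M.psiElem K)), fun F => ℓ (toH10 Ω (M.psiFace F))) := rfl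

lemma discreteResiduals_eq : M.discreteResiduals = (LinearMap.range M.residual : Set (Hm1 Ω)) := by
  ext ℓ
  have h : ∀ (cK cF : Finset (E d) → ℝ) (v : H10 Ω),
      ∑ K ∈ M.elems, (∫ x in hull K, cK K * fn v x) +
        ∑ F ∈ M.faces, ∫ x, cF F * trace Ω F v x ∂(surf F) = M.residual (cK, cF) v := by
    intro cK cF v
    simp only [residual_apply, integral_const_mul, chiElem_apply, chiFace_apply]
  simp only [discreteResiduals, Set.mem_ofPred_eq, SetLike.mem_coe, LinearMap.mem_range, h]
  constructor
  · rintro ⟨cK, cF, he⟩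
    exact ⟨(cK, cF), (ContinuousLinearMap.ext he).symm⟩
  · rintro ⟨⟨cK, cF⟩, rfl⟩
    exact ⟨cK, cF, fun v => rfl⟩

lemma chiFace_mem (hF : F ∈ M.faces) : chiFace Ω F ∈ LinearMap.range M.residual := by
  classical
  refine ⟨(0, Pi.single F 1), ?_⟩
  simp only [residual, LinearMap.coe_mk, AddHom.coe_mk, Pi.zero_apply, zero_smul,
    Finset.sum_const_zero, zero_add]
  rw [Finset.sum_eq_single F (fun L _ hL => by rw [Pi.single_eq_of_ne hL, zero_smul])
    (fun h => absurd hF h), Pi.single_eq_same, one_smul]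

/-! ### Biorthogonality and invariance -/

section duality
variable (hd : 1 ≤ d) (hΩb : Bornology.IsBounded Ω) (hMK : ∀ K ∈ M.elems, interior (hull K) ⊆ Ω)
  (hMF : ∀ F ∈ M.faces, interior (M.patch F) ⊆ Ω)

include hd hΩb in
lemma chiFace_eq_zero_of_not_subset (hS : interior (M.patch S) ⊆ Ω) (hF : F ∈ M.faces)
    (hSF : ¬S ⊆ F) {v : H10 Ω} (hv : (v : Pairs d) ∈ H10 (interior (M.patch S))) :
    chiFace Ω F v = 0 := by
  obtain ⟨-, K, hK, hFK⟩ := face_subset_elem hF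
  exact chiFace_eq_zero hS (isTraceOp_trace hd hΩb hF)
    (fun x hx hxS => hSF (subset_of_mem_interior_patch hK hFK hx hxS)) hv

lemma chiElem_eq_zero_of_not_subset (hS : interior (M.patch S) ⊆ Ω) (hK : K ∈ M.elems)
    (hSK : ¬S ⊆ K) {v : H10 Ω} (hv : (v : Pairs d) ∈ H10 (interior (M.patch S))) :
    chiElem Ω K v = 0 :=
  chiElem_eq_zero hS (fun _ hx hxS => hSK (subset_of_mem_interior_patch hK subset_rfl hx hxS)) hv

-- Biorthogonality for elements: no other element and no face contains all `d + 1` vertices of `K`,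
-- so only `χ_K` sees `ψ_K`.
include hd hΩb hMK in
lemma residual_psiElem (c : (Finset (E d) → ℝ) × (Finset (E d) → ℝ)) (hK : K ∈ M.elems) :
    M.residual c (toH10 Ω (M.psiElem K)) = c.1 K := by
  obtain ⟨h1, h2⟩ := toH10_psiElem hK (hMK K hK)
  have hK' : interior (M.patch K) ⊆ Ω := by rw [patch_elem hK]; exact hMK K hK
  rw [← patch_elem hK] at h1
  rw [residual_apply, Finset.sum_eq_single K, Finset.sum_eq_zero, add_zero, chiElem_apply,
    integral_congr_ae (ae_restrict_of_ae h2), integral_psiElem hK, mul_one]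
  · intro F hF
    rw [chiFace_eq_zero_of_not_subset hd hΩb hK' hF ?_ h1, mul_zero]
    intro hKF
    have := Finset.card_le_card hKF
    rw [M.card_eq K hK, (face_subset_elem hF).1] at this
    omega
  · intro L hL hne
    rw [chiElem_eq_zero_of_not_subset hK' hL (fun h => hne (eq_of_subset hK hL h).symm) h1,
      mul_zero]
  · exact fun h => absurd hK h

-- Biorthogonality for faces: other faces are excluded by supports, but elements only by the
-- vanishing mean of `ψ_F` on each of them.
include hd hΩb hMF in
lemma residual_psiFace (c : (Finset (E d) → ℝ) × (Finset (E d) → ℝ)) (hF : F ∈ M.faces) :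
    M.residual c (toH10 Ω (M.psiFace F)) = c.2 F := by
  obtain ⟨h1, h2, h3⟩ := toH10_psiFace hd hF (hMF F hF)
  obtain ⟨hc, K, hK, hFK⟩ := face_subset_elem hF
  have hfin := isFiniteMeasure_surf_of_subset hd hK hFK hc
  rw [residual_apply, Finset.sum_eq_zero, zero_add, Finset.sum_eq_single F, chiFace_apply,
    integral_congr_ae (h3 F hfin _ (isTraceOp_trace hd hΩb hF)), integral_psiFace_face hd hF,
    mul_one]
  · intro G hG hne
    rw [chiFace_eq_zero_of_not_subset hd hΩb (hMF F hF) hG ?_ h1, mul_zero]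
    intro hFG
    exact hne (Finset.eq_of_subset_of_card_le hFG
      (by rw [hc, (face_subset_elem hG).1])).symm
  · exact fun h => absurd hF h
  · intro L hL
    rw [chiElem_apply, integral_congr_ae (ae_restrict_of_ae h2), integral_psiFace_elem hd hF hL,
      mul_zero]

include hd hΩb hMK hMF

/-- The operator reproduces discretized residuals. -/
lemma proj_residual (c : (Finset (E d) → ℝ) × (Finset (E d) → ℝ)) :
    M.proj (M.residual c) = M.residual c := by
  ext v
  rw [proj_eq_residual, residual_apply, residual_apply]
  congr 1
  · refine Finset.sum_congr rfl fun K hK => ?_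
    simp only [residual_psiElem hd hΩb hMK c hK]
  · refine Finset.sum_congr rfl fun F hF => ?_
    simp only [residual_psiFace hd hΩb hMF c hF]

/-- Local invariance on the patch of any set of vertices. -/
lemma proj_eqOnOpen_patch (hS : interior (M.patch S) ⊆ Ω) {ℓ : Hm1 Ω}
    (hℓ : M.InDiscreteOn (interior (M.patch S)) ℓ) :
    EqOnOpen (interior (M.patch S)) (M.proj ℓ) ℓ := by
  intro v hv
  obtain ⟨ℓ', hℓ', he⟩ := hℓ
  rw [discreteResiduals_eq] at hℓ'
  obtain ⟨c, rfl⟩ := hℓ'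
  have hsub : ∀ T, S ⊆ T → interior (M.patch T) ⊆ interior (M.patch S) := by
    intro T hST
    refine interior_mono fun x hx => ?_
    obtain ⟨K, hK, hTK, hxK⟩ := mem_patch.1 hx
    exact mem_patch.2 ⟨K, hK, hST.trans hTK, hxK⟩
  -- Writing the discrete representative as its own projection reduces the claim to equal terms. If
  -- the index contains `S`, its test function lives in the patch and the coefficients agree;
  -- otherwise its functional vanishes at `v`.
  rw [he v hv, ← proj_residual hd hΩb hMK hMF c, proj_eq_residual, proj_eq_residual,
    residual_apply, residual_apply]
  congr 1
  · refine Finset.sum_congr rfl fun K hK => ?_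
    by_cases hSK : S ⊆ K
    · have h1 := (toH10_psiElem hK (hMK K hK)).1
      rw [← patch_elem hK] at h1
      simp only
      rw [he _ (H10_mono (hsub K hSK) h1)]
    · rw [chiElem_eq_zero_of_not_subset hS hK hSK hv, mul_zero, mul_zero]
  · refine Finset.sum_congr rfl fun F hF => ?_
    by_cases hSF : S ⊆ F
    · have h1 := (toH10_psiFace hd hF (hMF F hF)).1
      simp only
      rw [he _ (H10_mono (hsub F hSF) h1)]
    · rw [chiFace_eq_zero_of_not_subset hd hΩb hS hF hSF hv, mul_zero, mul_zero]

end duality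

lemma isLinearMap_proj : IsLinearMap ℝ M.proj where
  map_add ℓ ℓ' := by
    simp only [proj, add_apply, add_smul, Finset.sum_add_distrib]
    abel
  map_smul c ℓ := by
    simp only [proj, smul_apply, smul_eq_mul, mul_smul, smul_add, Finset.smul_sum]

/-! ### Piecewise constant functions and Laplacians of finite element functions -/

lemma integral_eq_sum_hull {f : E d → ℝ} (hf : Integrable f)
    (h0 : ∀ᵐ x, x ∉ closure Ω → f x = 0) : ∫ x, f x = ∑ K ∈ M.elems, ∫ x in hull K, f x := by
  have hU : closure Ω = ⋃ K : M.elems, hull (K : Finset (E d)) := by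
    rw [← M.cover, iUnion_subtype]
  have hdis : Pairwise fun K L : M.elems =>
      AEDisjoint volume (hull (K : Finset (E d))) (hull (L : Finset (E d))) := by
    intro K L hne
    rw [AEDisjoint, measure_eq_zero_iff_ae_notMem]
    filter_upwards [ae_disjoint K.2 L.2 (fun e => hne (Subtype.ext e))] with x hx hxKL
    exact hx hxKL.1 hxKL.2
  have h1 : ∫ x, f x = ∫ x in closure Ω, f x :=
    (setIntegral_eq_integral_of_ae_compl_eq_zero h0).symm
  rw [h1, hU, integral_iUnion_ae (fun K => (isCompact_hull _).measurableSet.nullMeasurableSet)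
    hdis hf.integrableOn, tsum_fintype]
  exact Finset.sum_coe_sort M.elems fun K => ∫ x in hull K, f x
-- The function `g` is only known on `Ω`, but `K` lies in `Ω` up to its boundary, which is a null
-- set.
lemma ofL2_mem_discreteResiduals (hMK : ∀ K ∈ M.elems, interior (hull K) ⊆ Ω) (hΩ : IsOpen Ω)
    {g : Lp ℝ 2 (volume.restrict Ω)} (hg : g ∈ M.piecewiseConst) :
    ofL2 g ∈ LinearMap.range M.residual := by
  choose! c hc using hg
  refine ⟨(c, 0), ContinuousLinearMap.ext fun v => ?_⟩
  rw [residual_apply, ofL2_apply, ← integral_indicator hΩ.measurableSet]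
  have hi : IntegrableOn (fun x => g x * fn v x) Ω :=
    (Lp.memLp g).integrable_mul ((Lp.memLp (fn v)).restrict Ω)
  rw [integral_eq_sum_hull (M := M) ((integrable_indicator_iff hΩ.measurableSet).2 hi)]
  · simp only [Pi.zero_apply, zero_mul, Finset.sum_const_zero, add_zero]
    refine Finset.sum_congr rfl fun K hK => ?_
    rw [chiElem_apply, ← integral_const_mul]
    refine setIntegral_congr_ae (isCompact_hull K).measurableSet ?_
    have h := hc K hK
    rw [ae_restrict_iff' hΩ.measurableSet] at h
    filter_upwards [h, ae_notMem_frontier K] with x h1 h2 hxK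
    have hxΩ := hMK K hK (h2 hxK)
    rw [indicator_of_mem hxΩ, h1 hxΩ hxK]
  · exact Filter.Eventually.of_forall fun x hx => indicator_of_notMem (fun h => hx (subset_closure h)) _

open Classical in
/-- The divergence theorem on an element, for derivatives in a fixed direction. -/
lemma exists_integral_fderiv_eq (hd : 1 ≤ d) (hK : K ∈ M.elems) (e : E d) :
    ∃ c : E d → ℝ, ∀ φ : E d → ℝ, ContDiff ℝ 1 φ →
      ∫ x in hull K, fderiv ℝ φ x e = ∑ z ∈ K, c z * ∫ x, φ x ∂(surf (K.erase z)) := by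
  obtain ⟨n, rfl⟩ : ∃ n, d = n + 1 := ⟨d - 1, by omega⟩
  obtain ⟨p, hp⟩ : K.Nonempty := Finset.card_pos.1 (by rw [M.card_eq K hK]; omega)
  -- Edge directions at one fixed vertex `p` suffice, since they span the space.
  have key : ∀ q ∈ K, ∃ a b : ℝ, ∀ φ : E (n + 1) → ℝ, ContDiff ℝ 1 φ →
      ∫ x in hull K, fderiv ℝ φ x (q - p) = a * (∫ x, φ x ∂(surf (K.erase p))) +
        b * ∫ x, φ x ∂(surf (K.erase q)) := by
    intro q hq
    by_cases hqp : q = p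
    · exact ⟨0, 0, fun φ _ => by simp [hqp]⟩
    have hqe : q ∈ K.erase p := Finset.mem_erase.2 ⟨hqp, hq⟩
    obtain ⟨w, hwi, hw⟩ := exists_enum ((K.erase p).erase q) (m := n) (by
      rw [Finset.card_erase_of_mem hqe, Finset.card_erase_of_mem hp, M.card_eq K hK]; rfl)
    have hwS : ∀ i, w i ∈ (K.erase p).erase q :=
      fun i => hw ▸ Finset.mem_image_of_mem w (Finset.mem_univ i)
    have hwq : ∀ i, w i ≠ q := fun i => Finset.ne_of_mem_erase (hwS i)
    have hwp : ∀ i, w i ≠ p := fun i => Finset.ne_of_mem_erase (Finset.mem_of_mem_erase (hwS i))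
    have hwK : ∀ i, w i ∈ K := fun i =>
      Finset.mem_of_mem_erase (Finset.mem_of_mem_erase (hwS i))
    have hlin := linearIndependent_sub (M.indep K hK) hp
      (u := (Fin.cons q w : Fin (n + 1) → E (n + 1)))
      (Fin.cons_injective_iff.2 ⟨by rintro ⟨i, hi⟩; exact hwq i hi, hwi⟩)
      (Fin.cases hq hwK) (Fin.cases hqp hwp)
    obtain ⟨a, b, hab⟩ := exists_integral_fderiv_edge_eq hlin
    have hr : range w = ((K.erase p).erase q : Finset (E (n + 1))) := by rw [← hw]; simp
    have s1 : (insert q (range w) : Set (E (n + 1))) = (K.erase p : Finset (E (n + 1))) := by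
      rw [hr, ← Finset.coe_insert, Finset.insert_erase hqe]
    have s2 : (insert p (range w) : Set (E (n + 1))) = (K.erase q : Finset (E (n + 1))) := by
      rw [hr, Finset.erase_right_comm, ← Finset.coe_insert,
        Finset.insert_erase (Finset.mem_erase.2 ⟨Ne.symm hqp, hp⟩)]
    rw [s1, s2, ← Finset.coe_insert, Finset.insert_erase hp] at hab
    exact ⟨a, b, hab⟩
  choose! a b hab using key
  have hB := isBary hK
  -- Barycentric coordinates of `p + e` sum to one and reproduce that point, so they are
  -- coefficients of `e` in the edges `q - p`.
  set β : E (n + 1) → ℝ := fun q => bary K q (p + e) with hβ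
  have he : e = ∑ q ∈ K, β q • (q - p) := by
    simp only [smul_sub, Finset.sum_sub_distrib, ← Finset.sum_smul, hβ, hB.sum_smul,
      hB.sum_eq_one, one_smul, add_sub_cancel_left]
  refine ⟨fun z => β z * b z + if z = p then ∑ q ∈ K, β q * a q else 0, fun φ hφ => ?_⟩
  have hi : ∀ q ∈ K, IntegrableOn (fun x => β q * fderiv ℝ φ x (q - p)) (hull K) := fun q _ =>
    (Continuous.continuousOn (continuous_const.mul ((hφ.continuous_fderiv one_ne_zero).clm_apply
      continuous_const))).integrableOn_compact (isCompact_hull K)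
  have h1 : ∫ x in hull K, fderiv ℝ φ x e =
      ∑ q ∈ K, β q * ∫ x in hull K, fderiv ℝ φ x (q - p) := by
    simp only [← integral_const_mul]
    rw [← integral_finsetSum _ hi]
    conv_lhs => rw [he]
    simp only [map_sum, map_smul, smul_eq_mul]
  rw [h1]
  simp only [add_mul, Finset.sum_add_distrib, ite_mul, zero_mul, Finset.sum_ite_eq', hp, if_true]
  rw [Finset.sum_mul, ← Finset.sum_add_distrib]
  refine Finset.sum_congr rfl fun q hq => ?_
  rw [hab q hq φ hφ]
  ring

/-- The gradient of `V` is constant on each element, so the divergence theorem there leaves only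
facet integrals of the test function; element terms do not occur. -/
lemma laplacian_mem_discreteResiduals (hd : 1 ≤ d) (hΩ : IsOpen Ω) (hΩb : Bornology.IsBounded Ω)
    {V : H10 Ω} (hV : V ∈ M.feSpace) : laplacian V ∈ LinearMap.range M.residual := by
  classical
  have hgrad : ∀ K ∈ M.elems, ∃ e : E d, ∀ᵐ x, x ∈ hull K → grad V x = e := by
    intro K hK
    obtain ⟨a, ha⟩ := hV K hK
    rw [ae_restrict_iff' (isCompact_hull K).measurableSet] at ha
    have haf : ∀ x, HasFDerivAt a (a.linear.toContinuousLinearMap) x := fun x => by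
      have h : (a : E d → ℝ) = fun x => a.linear.toContinuousLinearMap x + a 0 := by
        funext x
        simpa using a.map_vadd 0 x
      rw [h]
      exact (ContinuousLinearMap.hasFDerivAt _).add_const _
    have hac : ContDiff ℝ 1 a := by
      have h : (a : E d → ℝ) = fun x => a.linear.toContinuousLinearMap x + a 0 := by
        funext x
        simpa using a.map_vadd 0 x
      rw [h]
      exact (ContinuousLinearMap.contDiff _).add contDiff_const
    have h := grad_ae_eq_gradient isOpen_interior hac V
      (ha.mono fun x hx hxi => hx (interior_subset hxi))
    refine ⟨(InnerProductSpace.toDual ℝ (E d)).symm a.linear.toContinuousLinearMap, ?_⟩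
    filter_upwards [h, ae_notMem_frontier K] with x h1 h2 hxK
    rw [h1 (h2 hxK), gradient, (haf x).fderiv]
  choose! e he using hgrad
  have hdiv := fun K (hK : K ∈ M.elems) => exists_integral_fderiv_eq hd hK (e K)
  choose! c hc using hdiv
  -- For a facet that is no interelement face the value `0` is the right one: the facet misses `Ω`,
  -- and test functions vanish on it.
  let B : Finset (E d) → Hm1 Ω := fun G => if G ∈ M.faces then chiFace Ω G else 0
  have hBmem : ∀ G, B G ∈ LinearMap.range M.residual := fun G => by
    by_cases hG : G ∈ M.faces
    · simp only [B, hG, if_true]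
      exact chiFace_mem hG
    · simp only [B, hG, if_false]
      exact zero_mem _
  -- An interelement face occurs once for each adjacent element, and its two contributions add up.
  suffices h : laplacian V = ∑ K ∈ M.elems, ∑ z ∈ K, (-c K z) • B (K.erase z) by
    rw [h]
    exact sum_mem fun K _ => sum_mem fun z _ => Submodule.smul_mem _ _ (hBmem _)
  refine ext_of_eq_on_tests fun φ hφ v hv => ?_
  have hB : ∀ K ∈ M.elems, ∀ z ∈ K, B (K.erase z) v = ∫ x, φ x ∂(surf (K.erase z)) := by
    intro K hK z hz
    by_cases hG : K.erase z ∈ M.faces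
    · simp only [B, hG, if_true]
      exact chiFace_apply_test (isTraceOp_trace hd hΩb hG) hφ hv
    · simp only [B, hG, if_false]
      rw [zero_apply]
      exact (setIntegral_eq_zero_of_forall_eq_zero fun x hx =>
        hφ.eq_zero (hull_erase_disjoint hd hΩ hK hz hG hx)).symm
  rw [laplacian_apply, sum_apply]
  have hv2 : (grad v : E d → E d) =ᵐ[volume] gradient φ := hv.2
  rw [integral_eq_sum_hull (M := M) (L2.integrable_inner (grad V) (grad v)),
    ← Finset.sum_neg_distrib]
  · refine Finset.sum_congr rfl fun K hK => ?_
    have h1 : ∫ x in hull K, ⟪grad V x, grad v x⟫ = ∫ x in hull K, fderiv ℝ φ x (e K) := by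
      refine setIntegral_congr_ae (isCompact_hull K).measurableSet ?_
      filter_upwards [he K hK, hv2] with x h1 h2 hx
      rw [h1 hx, h2, real_inner_comm, inner_gradient]
    rw [h1, hc K hK φ hφ.contDiff_one, sum_apply, ← Finset.sum_neg_distrib]
    refine Finset.sum_congr rfl fun z hz => ?_
    rw [smul_apply, hB K hK z hz, smul_eq_mul, neg_mul]
  · filter_upwards [hv2] with x hx hxΩ
    rw [hx, hφ.gradient_eq_zero fun h => hxΩ (subset_closure h), inner_zero_right]

end Mesh

end FEM

end

/-! ### Local and global invariance of the projection. -/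

theorem theoremT {d : ℕ} (hd : 1 ≤ d) {Ω : Set (FEM.E d)} (hΩo : IsOpen Ω)
    (hΩb : Bornology.IsBounded Ω) (hΩc : IsConnected Ω) (M : FEM.Mesh Ω)
    (hK : ∀ K ∈ M.elems, interior (FEM.hull K) ⊆ Ω)
    (hF : ∀ F ∈ M.faces, interior (M.patch F) ⊆ Ω) :
    -- the test functions belong to `H¹₀(Ω)`, and faces have trace operators
    (∀ K ∈ M.elems, (FEM.fn (FEM.toH10 Ω (M.psiElem K)) : FEM.E d → ℝ) =ᵐ[volume] M.psiElem K) ∧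
    (∀ F ∈ M.faces, (FEM.fn (FEM.toH10 Ω (M.psiFace F)) : FEM.E d → ℝ) =ᵐ[volume] M.psiFace F) ∧
    (∀ F ∈ M.faces, FEM.IsTraceOp F (FEM.trace Ω F)) ∧
    -- local invariance
    (∀ ℓ : FEM.Hm1 Ω,
      (∀ K ∈ M.elems, M.InDiscreteOn (interior (FEM.hull K)) ℓ →
        FEM.EqOnOpen (interior (FEM.hull K)) (M.proj ℓ) ℓ) ∧
      (∀ F ∈ M.faces, M.InDiscreteOn (interior (M.patch F)) ℓ →
        FEM.EqOnOpen (interior (M.patch F)) (M.proj ℓ) ℓ)) ∧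
    -- `M.proj` is a linear projection onto the discretized residuals
    IsLinearMap ℝ M.proj ∧
    (∀ ℓ, M.proj (M.proj ℓ) = M.proj ℓ) ∧
    range M.proj = M.discreteResiduals ∧
    -- global invariance
    (∀ ℓ ∈ M.discreteResiduals, M.proj ℓ = ℓ) ∧
    (∀ V ∈ M.feSpace, M.proj (FEM.laplacian V) = FEM.laplacian V) ∧
    (∀ g ∈ M.piecewiseConst, M.proj (FEM.ofL2 g) = FEM.ofL2 g) := by
  have hproj := fun c => FEM.Mesh.proj_residual hd hΩb hK hF (M := M) c
  have hmem : ∀ ℓ ∈ LinearMap.range M.residual, M.proj ℓ = ℓ := by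
    rintro _ ⟨c, rfl⟩
    exact hproj c
  refine ⟨fun K hKM => (FEM.Mesh.toH10_psiElem hKM (hK K hKM)).2,
    fun F hFM => (FEM.Mesh.toH10_psiFace hd hFM (hF F hFM)).2.1,
    fun F hFM => FEM.Mesh.isTraceOp_trace hd hΩb hFM,
    fun ℓ => ⟨fun K hKM h => ?_, fun F hFM h =>
      FEM.Mesh.proj_eqOnOpen_patch hd hΩb hK hF (hF F hFM) h⟩,
    FEM.Mesh.isLinearMap_proj,
    fun ℓ => by rw [FEM.Mesh.proj_eq_residual ℓ, hproj], ?_, ?_,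
    fun V hV => hmem _ (FEM.Mesh.laplacian_mem_discreteResiduals hd hΩo hΩb hV),
    fun g hg => hmem _ (FEM.Mesh.ofL2_mem_discreteResiduals hK hΩo hg)⟩
  · rw [← FEM.Mesh.patch_elem hKM] at h ⊢
    exact FEM.Mesh.proj_eqOnOpen_patch hd hΩb hK hF
      (by rw [FEM.Mesh.patch_elem hKM]; exact hK K hKM) h
  · rw [FEM.Mesh.discreteResiduals_eq]
    refine Subset.antisymm ?_ fun ℓ hℓ => ⟨ℓ, hmem ℓ hℓ⟩
    rintro _ ⟨ℓ, rfl⟩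
    exact ⟨_, (FEM.Mesh.proj_eq_residual ℓ).symm⟩
  · rw [FEM.Mesh.discreteResiduals_eq]
    exact hmem
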